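/- **Conventions.** A *boolean function* is a family $f=(f_n)_{n\ge 0}$, $f_n:\{0,1\}^n\times\{0,1\}^n\to\{0,1\}$. A *network* is a finite nonempty simple graph whose nodes and edges carry inputs (bit strings); a *distributed language* is a set of networks. The nodes of an $N$-node network have distinct identifiers in $\{0,\dots,\rho(N)-1\}$, where $\rho(N)\ge N$ is a fixed polynomially bounded function. A *verifier* of radius $r$ is a map $A$ that decides, at each node $v$, from the view of $v$ (its identifier and the subgraph induced by the nodes at distance at most $r$ from $v$, with identifiers and inputs) and from the global certificates; it is not told $N$. Let $g:\mathbb N\to\mathbb R$. A language $L$ is in $\Sigma^G_k(g)$ if there are a constant radius $r$, a verifier $A$ of radius $r$ and $s(N)=O(g(N))$ such that, for every network $G$ with $N$ nodes and every assignment of identifiers, $$G\in L\iff \exists \ell_1\,\forall \ell_2\cdots \mathrm Q\,\ell_k\ \ \text{every node } v \text{ of } G \text{ accepts},$$ where the $\ell_i$ range over $\{0,1\}^{s(N)}$, each $\ell_i$ is seen by all nodes, and the quantifiers alternate; $\Pi^G_k(g)$ is defined in the same way with $\forall\ell_1$ first. Put $\Lambda_k(g)=\Sigma^G_k(g)$ for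 odd $k$ and $\Lambda_k(g)=\Pi^G_k(g)$ for even $k$. A boolean function $f$ is in $\Sigma^{cc}_k(O(g))$ if there are $s(n)=O(g(n))$ and functions $A_n,B_n$ such that for all $n$ and all $x,y\in\{0,1\}^n$ $$f_n(x,y)=1\iff \exists \ell_1\,\forall \ell_2\cdots \mathrm Q\,\ell_k\ \ A_n(\ell_1,\dots,\ell_k,x)=B_n(\ell_1,\dots,\ell_k,y)=1,$$ where the $\ell_i$ range over $\{0,1\}^{s(n)}$ and the quantifiers alternate; $\Pi^{cc}_k(O(g))$ is defined in the same way with $\forall\ell_1$ first. A *gadget encoding* consists of $n_0$ and functions $m,p$ with $2m(n)+p(n)=n$ and $p(n)\ge 2$ for $n\ge n_0$, and, for each $n$, an isomorphism-invariant map $\varphi_n$ from the graphs on $m(n)$ nodes to $\{0,1\}^n$, surjective for $n\ge n_0$. For graphs $H_A,H_B$ on $m(n)$ nodes, let $G(H_A,H_B)$ be the $n$-node network made of disjoint copies of $H_A$, $H_B$ and of a path on $p(n)$ nodes, with the first path node $v_A$ joined to all of $H_A$ and the last path node $v_B$ joined to all of $H_B$; $v_A$ and $v_B$ carry two distinct marks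 and there are no other inputs. The associated language $L_f$ is the set of all networks isomorphic, for some $n\ge n_0$, to some $G(H_A,H_B)$ with $f_n(\varphi_n(H_A),\varphi_n(H_B))=1$. **Theorem.** For every boolean function $f$ there is a distributed language $L_f$, associated with $f$ by a gadget encoding, such that for every polynomially bounded identifier range $\rho$, every $g$ with $g(n)=\Omega(\log n)$ and every $k\ge 1$: $$L_f\in\Lambda_k(g)\iff f \text{ is on the } k\text{-th level of the communication hierarchy with } O(g(n)) \text{ bits,}$$ that is, $f\in\Sigma^{cc}_k(O(g))$ if $k$ is odd, and $f\in\Pi^{cc}_k(O(g))$ if $k$ is even. -/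

import Mathlib

open Filter Asymptotics

namespace CertHierarchy

/-! ### Networks and languages -/

/-- A finite nonempty simple graph whose nodes and edges carry inputs (bit strings). -/
structure LabeledGraph where
  order : ℕ
  order_pos : 0 < order
  graph : SimpleGraph (Fin order)
  nodeInput : Fin order → List Bool
  edgeInput : graph.edgeSet → List Bool

/-- A range `{0, …, ρ N - 1}` for the identifiers of an `N`-node network: large enough for
distinct identifiers, and of size polynomial in `N`. -/
def IsPolyIdRange (ρ : ℕ → ℕ) : Prop :=
  (∀ N, N ≤ ρ N) ∧ ∃ c : ℕ, ∀ N, 1 ≤ N → ρ N ≤ c * N ^ c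

/-- Distinct identifiers from the range `{0, …, ρ N - 1}`, `N` being the number of nodes. -/
def IsIdAssignment (ρ : ℕ → ℕ) (G : LabeledGraph) (id : Fin G.order → ℕ) : Prop :=
  Function.Injective id ∧ ∀ v, id v < ρ G.order

/-! ### Local verification -/

/-- What a node knows about its neighbourhood. Nodes are named by their identifiers only. -/
structure View where
  /-- the identifier of the node itself -/
  center : ℕ
  /-- the pairs (identifier, node input) -/
  nodes : Set (ℕ × List Bool)
  /-- the triples (identifier, identifier of a neighbour, edge input) -/
  edges : Set (ℕ × ℕ × List Bool)

/-- The nodes at distance at most `r` from `v`. -/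
def ball (G : LabeledGraph) (r : ℕ) (v : Fin G.order) : Set (Fin G.order) :=
  {u | ∃ q : G.graph.Walk v u, q.length ≤ r}

/-- The radius-`r` view of `v`: the subgraph induced by the ball of radius `r` around `v`, with the
identifiers and the inputs. -/
def view (G : LabeledGraph) (id : Fin G.order → ℕ) (r : ℕ) (v : Fin G.order) : View where
  center := id v
  nodes := {a | ∃ u ∈ ball G r v, a = (id u, G.nodeInput u)}
  edges := {a | ∃ u ∈ ball G r v, ∃ w ∈ ball G r v, ∃ h : G.graph.Adj u w,
    a = (id u, id w, G.edgeInput ⟨s(u, w), G.graph.mem_edgeSet.2 h⟩)}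

/-- A verifier decides from the view of a node and the list of the global certificates. It is
uniform: it is not told the number of nodes. -/
abbrev Verifier := View → List (List Bool) → Bool

/-- The two players of the game. -/
inductive Player
  | prover
  | disprover

/-- The opponent. -/
def Player.other : Player → Player
  | .prover => .disprover
  | .disprover => .prover

/-- `Alternates s k a P`: `Q₁ ℓ₁, Q₂ ℓ₂, …, Q_k ℓ_k, P [ℓ₁, …, ℓ_k]`, where the `ℓᵢ` range over the
bit strings of length `s`, the quantifiers alternate, and `Q₁` is `∃` if `a` is the prover and
`∀` if `a` is the disprover. -/
def Alternates (s : ℕ) : ℕ → Player → (List (List Bool) → Prop) → Prop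
  | 0, _, P => P []
  | k + 1, .prover, P =>
      ∃ l : List Bool, l.length = s ∧ Alternates s k .disprover (fun ls => P (l :: ls))
  | k + 1, .disprover, P =>
      ∀ l : List Bool, l.length = s → Alternates s k .prover (fun ls => P (l :: ls))

/-- The radius-`r` verifier `A` decides `L` with `k` alternating global certificates of `s N` bits
on `N`-node networks, player `a` going first. -/
def DecidesGlobal (ρ : ℕ → ℕ) (r : ℕ) (A : Verifier) (s : ℕ → ℕ) (k : ℕ) (a : Player)
    (L : Set LabeledGraph) : Prop :=
  ∀ (G : LabeledGraph) (id : Fin G.order → ℕ), IsIdAssignment ρ G id →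
    (G ∈ L ↔ Alternates (s G.order) k a (fun ls => ∀ v, A (view G id r v) ls = true))

/-- Languages decided, at some constant radius, with `k` alternating global certificates of
`O(g)` bits, player `a` going first. -/
def globalClass (ρ : ℕ → ℕ) (a : Player) (k : ℕ) (g : ℕ → ℝ) : Set (Set LabeledGraph) :=
  {L | ∃ (s : ℕ → ℕ) (r : ℕ) (A : Verifier),
    (fun n => (s n : ℝ)) =O[atTop] g ∧ DecidesGlobal ρ r A s k a L}

/-- `Σ^G_k(g)`. -/
abbrev SigmaG (ρ : ℕ → ℕ) (k : ℕ) (g : ℕ → ℝ) := globalClass ρ .prover k g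

/-- `Π^G_k(g)`. -/
abbrev PiG (ρ : ℕ → ℕ) (k : ℕ) (g : ℕ → ℝ) := globalClass ρ .disprover k g

/-- `Λ_k(g)` for global certificates: `Σ_1, Π_2, Σ_3, Π_4, …`, so that the prover goes last. -/
def LambdaG (ρ : ℕ → ℕ) (k : ℕ) (g : ℕ → ℝ) : Set (Set LabeledGraph) :=
  if Odd k then SigmaG ρ k g else PiG ρ k g

/-! ### Nondeterministic communication complexity -/

/-- A boolean function of two `n`-bit inputs, for every `n`. -/
abbrev BooleanFunction := ∀ n : ℕ, (Fin n → Bool) → (Fin n → Bool) → Bool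

/-- Alice (`A`, who knows `x`) and Bob (`B`, who knows `y`) decide `f` with `k` alternating advice
strings of `s n` bits, player `a` going first. -/
def DecidesCC (A B : ∀ n : ℕ, List (List Bool) → (Fin n → Bool) → Bool) (s : ℕ → ℕ) (k : ℕ)
    (a : Player) (f : BooleanFunction) : Prop :=
  ∀ (n : ℕ) (x y : Fin n → Bool),
    Alternates (s n) k a (fun ls => A n ls x = true ∧ B n ls y = true) ↔ f n x y = true

/-- Functions decided with `k` alternating advice strings of `O(g)` bits, player `a` going first. -/
def ccClass (a : Player) (k : ℕ) (g : ℕ → ℝ) : Set BooleanFunction :=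
  {f | ∃ (s : ℕ → ℕ) (A B : ∀ n : ℕ, List (List Bool) → (Fin n → Bool) → Bool),
    (fun n => (s n : ℝ)) =O[atTop] g ∧ DecidesCC A B s k a f}

/-- `Σ^cc_k(O(g))`. -/
abbrev SigmaCC (k : ℕ) (g : ℕ → ℝ) := ccClass .prover k g

/-- `Π^cc_k(O(g))`. -/
abbrev PiCC (k : ℕ) (g : ℕ → ℝ) := ccClass .disprover k g

/-! ### Graphs made of a path joining two gadgets -/

/-- Nodes of the graph: Alice's gadget, the path, Bob's gadget. -/
inductive GadgetVertex (m p : ℕ)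
  | alice (i : Fin m)
  | path (i : Fin p)
  | bob (i : Fin m)

/-- Adjacency: the two gadgets are `HA` and `HB`; the path nodes are joined consecutively; the first
path node is joined to all of `HA` and the last one to all of `HB`. -/
def gadgetAdj {m p : ℕ} (HA HB : SimpleGraph (Fin m)) :
    GadgetVertex m p → GadgetVertex m p → Prop
  | .alice i, .alice j => HA.Adj i j
  | .bob i, .bob j => HB.Adj i j
  | .path i, .path j => (i : ℕ) + 1 = j ∨ (j : ℕ) + 1 = i
  | .alice _, .path i => (i : ℕ) = 0
  | .path i, .alice _ => (i : ℕ) = 0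
  | .bob _, .path i => (i : ℕ) + 1 = p
  | .path i, .bob _ => (i : ℕ) + 1 = p
  | .alice _, .bob _ => False
  | .bob _, .alice _ => False

/-- The graph made of the gadgets `HA` and `HB` and of a path on `p` nodes joining them. -/
def gadgetGraph {m : ℕ} (p : ℕ) (HA HB : SimpleGraph (Fin m)) :
    SimpleGraph (GadgetVertex m p) where
  Adj := gadgetAdj HA HB
  symm := ⟨by
    rintro (i | i | i) (j | j | j) h <;> simp only [gadgetAdj] at h ⊢
    · exact h.symm
    · exact h
    · exact h
    · exact h.symm
    · exact h
    · exact h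
    · exact h.symm⟩
  loopless := ⟨by
    rintro (i | i | i) h <;> simp [gadgetAdj] at h⟩

/-- Node inputs: the two ends of the path carry distinct marks, all other nodes carry nothing. -/
def gadgetInput {m p : ℕ} : GadgetVertex m p → List Bool
  | .path i => if (i : ℕ) = 0 then [false] else if (i : ℕ) + 1 = p then [true] else []
  | .alice _ => []
  | .bob _ => []

/-- The graph encodings of pairs of `n`-bit strings, for all `n ≥ n₀`. The encoding of `(x, y)` has
exactly `n` nodes: two gadgets on `m n` nodes and a path on `p n` nodes. The map `φ` reads an
`n`-bit string off the isomorphism class of a gadget, and every string is encoded by a gadget. -/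
structure GadgetEncoding where
  n₀ : ℕ
  m : ℕ → ℕ
  p : ℕ → ℕ
  size_eq : ∀ n, n₀ ≤ n → 2 * m n + p n = n
  two_le_p : ∀ n, n₀ ≤ n → 2 ≤ p n
  φ : ∀ n, SimpleGraph (Fin (m n)) → (Fin n → Bool)
  φ_iso : ∀ n (H H' : SimpleGraph (Fin (m n))), Nonempty (H ≃g H') → φ n H = φ n H'
  φ_surjective : ∀ n, n₀ ≤ n → Function.Surjective (φ n)

/-- The language of all graphs of order `n ≥ n₀` made of a path joining two gadgets, without any
inputs besides the marks at the ends of the path, that encode `x`, `y` with `f(x, y) = 1`. -/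
def gadgetLanguage (E : GadgetEncoding) (f : BooleanFunction) : Set LabeledGraph :=
  {G | E.n₀ ≤ G.order ∧
    ∃ (HA HB : SimpleGraph (Fin (E.m G.order)))
      (e : G.graph ≃g gadgetGraph (E.p G.order) HA HB),
      (∀ v, G.nodeInput v = gadgetInput (e v)) ∧
      (∀ d, G.edgeInput d = []) ∧
      f G.order (E.φ G.order HA) (E.φ G.order HB) = true}

end CertHierarchy

/-!
The gadgets have about `n / 2` nodes, so that there are at least `2 ^ n` isomorphism classes of
them, and the path has a length that tends to infinity with `n`, but extremely slowly
(`exists_gadgetEncoding`).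

*From verification to communication* (`mem_ccClass_of_mem_globalClass`). Once the path is longer
than twice the radius of the verifier, no node sees both gadgets. Alice and Bob build the network
that encodes their inputs, with fixed identifiers, and each of them runs the verifier at the nodes
whose view does not depend on the input of the other (`exists_simulation`). The finitely many
smaller `n` do not matter for the asymptotics: there the prover, who moves last, reveals `x`
(`exists_trivial_protocol`). That the language depends on `f (x, y)` only is due to the fact that
the gadgets can be recovered from the network, as the sets of nodes at distance `p` from an end of
the path (`nonempty_iso_of_gadgetGraph_iso`).

*From communication to verification* (`mem_globalClass_of_mem_ccClass`). Each end of the path sees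
the gadget next to it, and can play the part of Alice or Bob in the protocol. What remains is to
verify that the network is a gadget network, and to make `n` known to the nodes. For this the
prover, who moves last, adds a `Layout` to the last certificate: the number `n`, the identifiers of
the two nodes at either end of the path, and a function that sends the identifiers of the path
nodes to their positions. The positions exclude further components, such as cycles, which no
bounded-radius view could tell from the inside of the path: every node of the path has a neighbour
at the preceding position, down to the first node, which is unique because its identifier is known.
Thus local checks at radius one characterise the gadget networks
(`isLocallyValid_view`, `FitsLayout.exists_iso`).

The layout has to fit into `O(log n)` bits, although the path has unboundedly many nodes. Some `p²`
bit positions suffice to tell `p` identifiers apart, and a table sends the patterns of bits at these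
positions to the positions on the path. There are few such functions if `p` grows slowly enough
(`exists_hash_family`).
-/

namespace CertHierarchy

/-! ### Alternating quantifiers -/

/-- The player who has to start a game of `k` moves for the prover to make the last one. -/
def starter : ℕ → Player
  | 0 => .disprover
  | k + 1 => (starter k).other

theorem starter_eq_ite (k : ℕ) : starter k = if Odd k then .prover else .disprover := by
  induction k with
  | zero => simp [starter]
  | succ k ih =>
    rw [starter, ih]
    by_cases h : Odd k
    · rw [if_pos h, if_neg (by simpa [Nat.odd_add_one] using h)]; rfl
    · rw [if_neg h, if_pos (by simpa [Nat.odd_add_one] using h)]; rfl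

/-- The domain of the quantifiers never being empty, quantifying a constant is vacuous. -/
theorem alternates_const (s k : ℕ) (a : Player) (c : Prop) :
    Alternates s k a (fun _ => c) ↔ c := by
  induction k generalizing a with
  | zero => rfl
  | succ k ih =>
    have hex : ∃ l : List Bool, l.length = s := ⟨List.replicate s false, by simp⟩
    cases a
    · simp only [Alternates, ih]
      exact ⟨fun ⟨_, _, h⟩ => h, fun h => hex.imp fun _ hl => ⟨hl, h⟩⟩
    · simp only [Alternates, ih]
      exact ⟨fun h => hex.elim h, fun h _ _ => h⟩

/-- Renaming the certificates: if `τ` maps the strings of length `s` onto those of length `t`,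
then a game about `τ ℓ₁, …, τ ℓ_k` is a game on strings of length `t`. -/
theorem alternates_iff_of_map {s t : ℕ} {τ : List Bool → List Bool}
    (hτ : ∀ l, l.length = s → (τ l).length = t)
    (hsurj : ∀ c : List Bool, c.length = t → ∃ l, l.length = s ∧ τ l = c) (k : ℕ) (a : Player)
    {P Q : List (List Bool) → Prop}
    (hPQ : ∀ ls : List (List Bool), ls.length = k → (∀ l ∈ ls, l.length = s) →
      (P ls ↔ Q (ls.map τ))) :
    Alternates s k a P ↔ Alternates t k a Q := by
  induction k generalizing a P Q with
  | zero => simpa [Alternates] using hPQ [] rfl (by simp)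
  | succ k ih =>
    have step (b : Player) (l : List Bool) (hl : l.length = s) :
        Alternates s k b (fun ls => P (l :: ls)) ↔ Alternates t k b (fun ls => Q (τ l :: ls)) :=
      ih b fun ls hls hmem => hPQ (l :: ls) (by simp [hls]) (by simpa [hl] using hmem)
    cases a
    · constructor
      · rintro ⟨l, hl, h⟩
        exact ⟨τ l, hτ l hl, (step _ l hl).1 h⟩
      · rintro ⟨c, hc, h⟩
        obtain ⟨l, hl, rfl⟩ := hsurj c hc
        exact ⟨l, hl, (step _ l hl).2 h⟩
    · constructor
      · intro h c hc
        obtain ⟨l, hl, rfl⟩ := hsurj c hc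
        exact (step _ l hl).1 (h l hl)
      · intro h l hl
        exact (step _ l hl).2 (h _ (hτ l hl))

theorem alternates_congr {s k : ℕ} {a : Player} {P Q : List (List Bool) → Prop}
    (hPQ : ∀ ls : List (List Bool), ls.length = k → (∀ l ∈ ls, l.length = s) → (P ls ↔ Q ls)) :
    Alternates s k a P ↔ Alternates s k a Q :=
  alternates_iff_of_map (τ := id) (fun _ h => h) (fun c hc => ⟨c, hc, rfl⟩) k a (by simpa using hPQ)

/-- The last move of the game belongs to the prover. -/
theorem alternates_starter_succ (s k : ℕ) (P : List (List Bool) → Prop) :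
    Alternates s (k + 1) (starter (k + 1)) P ↔
      Alternates s k (starter (k + 1)) (fun ls => ∃ l : List Bool, l.length = s ∧ P (ls ++ [l])) := by
  induction k generalizing P with
  | zero => rfl
  | succ k ih =>
    have hother : starter (k + 1 + 1) = (starter (k + 1)).other := rfl
    rw [hother]
    cases h : starter (k + 1)
    · rw [h] at ih
      exact forall₂_congr fun l _ => ih (fun ls => P (l :: ls))
    · rw [h] at ih
      exact exists_congr fun l => and_congr_right fun _ => ih (fun ls => P (l :: ls))

/-! ### Separating few identifiers with few bits -/

/-- Multiplied by `2 ^ t`, an upper bound for the number of ways to choose `q ^ 2` positions in a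
`t`-bit string and a table that sends every pattern of bits at these positions to one of `q`
values. -/
def hashBound (q : ℕ) : ℕ := (q * q).factorial * 2 ^ (q * q) * q ^ 2 ^ (q * q)

theorem pow_le_two_pow_mul_factorial (t k : ℕ) : t ^ k ≤ 2 ^ t * (k.factorial * 2 ^ k) := by
  calc t ^ k ≤ t.ascFactorial k := Nat.pow_succ_le_ascFactorial t k
    _ = k.factorial * (t + k - 1).choose k := Nat.ascFactorial_eq_factorial_mul_choose' t k
    _ ≤ k.factorial * 2 ^ (t + k) := by
        gcongr
        exact (Nat.choose_le_two_pow _ _).trans (Nat.pow_le_pow_right two_pos (by omega))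
    _ = 2 ^ t * (k.factorial * 2 ^ k) := by ring

/-- A finite type with at most `2 ^ s` elements can be decoded from strings of length `s`. -/
theorem exists_decoding (α : Type*) [Fintype α] [Nonempty α] {s : ℕ} (h : Fintype.card α ≤ 2 ^ s) :
    ∃ dec : List Bool → α, ∀ x, ∃ l : List Bool, l.length = s ∧ dec l = x := by
  classical
  obtain ⟨emb⟩ : Nonempty (α ↪ List.Vector Bool s) :=
    Function.Embedding.nonempty_of_card_le (by simpa [card_vector] using h)
  refine ⟨fun l => if hl : l.length = s then Function.invFun emb ⟨l, hl⟩ else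
    Classical.arbitrary α, fun x => ⟨(emb x).1, (emb x).2, ?_⟩⟩
  exact (dif_pos (emb x).2).trans (Function.leftInverse_invFun emb.injective x)

/-- A small family of functions on `{0, …, 2 ^ t - 1}` that contains, for all distinct
`x₀, …, x_{p-1}`, a function sending each `xᵢ` to `i`. For each pair `(i, j)` one bit position is
chosen at which `xᵢ` and `xⱼ` differ; the bits at these positions determine `i`. -/
theorem exists_hash_family {t p : ℕ} (ht : 0 < t) (hp : 0 < p) (h : hashBound p ≤ 2 ^ t) :
    ∃ F : Fin (2 ^ (2 * t)) → ℕ → ℕ, ∀ x : Fin p → ℕ, Function.Injective x →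
      (∀ i, x i < 2 ^ t) → ∃ j, ∀ i, F j (x i) = i := by
  classical
  have : Nonempty (Fin t) := ⟨⟨0, ht⟩⟩
  have : Nonempty (Fin p) := ⟨⟨0, hp⟩⟩
  let α := (Fin p × Fin p → Fin t) × ((Fin p × Fin p → Bool) → Fin p)
  have hcard : Fintype.card α ≤ 2 ^ (2 * t) := by
    calc Fintype.card α = t ^ (p * p) * p ^ 2 ^ (p * p) := by simp [α]
      _ ≤ 2 ^ t * ((p * p).factorial * 2 ^ (p * p)) * p ^ 2 ^ (p * p) := by
          gcongr; exact pow_le_two_pow_mul_factorial _ _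
      _ = 2 ^ t * hashBound p := by rw [hashBound]; ring
      _ ≤ 2 ^ t * 2 ^ t := by gcongr
      _ = 2 ^ (2 * t) := by ring
  obtain ⟨emb⟩ : Nonempty (α ↪ Fin (2 ^ (2 * t))) :=
    Function.Embedding.nonempty_of_card_le (by simpa using hcard)
  refine ⟨fun j x => (Function.invFun emb j).2
    (fun ij => x.testBit ((Function.invFun emb j).1 ij)), fun x hx hlt => ?_⟩
  have hbit (ij : Fin p × Fin p) : ∃ b : Fin t, ij.1 ≠ ij.2 →
      (x ij.1).testBit b ≠ (x ij.2).testBit b := by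
    by_cases hne : ij.1 = ij.2
    · exact ⟨Classical.arbitrary _, fun h => absurd hne h⟩
    · obtain ⟨b, hb⟩ := Nat.exists_testBit_ne_of_ne (hx.ne hne)
      have hbt : b < t := by
        by_contra hle
        have hpow : 2 ^ t ≤ 2 ^ b := Nat.pow_le_pow_right two_pos (by omega)
        rw [Nat.testBit_lt_two_pow ((hlt _).trans_le hpow),
          Nat.testBit_lt_two_pow ((hlt _).trans_le hpow)] at hb
        exact hb rfl
      exact ⟨⟨b, hbt⟩, fun _ => hb⟩
  choose b hb using hbit
  let pattern : Fin p → Fin p × Fin p → Bool := fun i ij => (x i).testBit (b ij)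
  have hpattern : Function.Injective pattern := fun i j hij => by
    by_contra hne
    exact hb (i, j) hne (congrFun hij (i, j))
  refine ⟨emb (b, Function.invFun pattern), fun i => ?_⟩
  beta_reduce
  rw [Function.leftInverse_invFun emb.injective]
  exact congrArg Fin.val (Function.leftInverse_invFun hpattern i)

/-! ### The gadget encoding -/

/-- The number of path nodes in the network that encodes two `n`-bit strings: it tends to infinity,
but so slowly that `O(log n)` bits describe a numbering of the path nodes. -/
def pathLength (n : ℕ) : ℕ :=
  Nat.findGreatest (fun q => q % 2 = n % 2 ∧ hashBound q ≤ n) (n / 2)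

theorem tendsto_pathLength : Tendsto pathLength atTop atTop := by
  refine tendsto_atTop.2 fun K => ?_
  filter_upwards [eventually_ge_atTop (2 * (K + 1) + hashBound K + hashBound (K + 1))] with n hn
  rcases Nat.mod_two_eq_zero_or_one (n + K) with h | h
  · exact Nat.le_findGreatest (by omega) ⟨by omega, by omega⟩
  · exact (Nat.le_add_right K 1).trans (Nat.le_findGreatest (by omega) ⟨by omega, by omega⟩)

theorem two_mul_pathLength_le (n : ℕ) : 2 * pathLength n ≤ n := by
  have : pathLength n ≤ n / 2 := Nat.findGreatest_le _
  omega

theorem pathLength_spec {n : ℕ} (h : pathLength n ≠ 0) :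
    pathLength n % 2 = n % 2 ∧ hashBound (pathLength n) ≤ n :=
  Nat.findGreatest_of_ne_zero rfl h

theorem factorial_mul_le_two_pow_choose {m : ℕ} (hm : 16 ≤ m) :
    2 ^ (4 * m) * m.factorial ≤ 2 ^ m.choose 2 := by
  induction m, hm using Nat.le_induction with
  | base => decide +kernel
  | succ m hm ih =>
    have h : 16 * (m + 1) ≤ 2 ^ m := by
      clear ih
      induction m, hm using Nat.le_induction with
      | base => norm_num
      | succ m hm ih => rw [pow_succ]; omega
    have hchoose : (m + 1).choose 2 = m + m.choose 2 := by
      rw [Nat.choose_succ_succ' m 1, Nat.choose_one_right]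
    calc 2 ^ (4 * (m + 1)) * (m + 1).factorial
        = (16 * (m + 1)) * (2 ^ (4 * m) * m.factorial) := by
          rw [Nat.factorial_succ, mul_add, pow_add]; ring
      _ ≤ 2 ^ m * 2 ^ m.choose 2 := Nat.mul_le_mul h ih
      _ = 2 ^ (m + 1).choose 2 := by rw [hchoose, pow_add]

/-- Being isomorphic, for graphs on `m` nodes. -/
def isoSetoid (m : ℕ) : Setoid (SimpleGraph (Fin m)) where
  r H H' := Nonempty (H ≃g H')
  iseqv := ⟨fun _ => ⟨.refl⟩, fun ⟨e⟩ => ⟨e.symm⟩, fun ⟨e⟩ ⟨e'⟩ => ⟨e.trans e'⟩⟩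

theorem two_pow_choose_le_card_simpleGraph (m : ℕ) :
    2 ^ m.choose 2 ≤ Nat.card (SimpleGraph (Fin m)) := by
  classical
  let g : Set {e : Sym2 (Fin m) // ¬ e.IsDiag} → SimpleGraph (Fin m) :=
    fun s => SimpleGraph.fromEdgeSet (Subtype.val '' s)
  have hg : Function.Injective g := fun s t hst => by
    have h := congrArg SimpleGraph.edgeSet hst
    have hdiff (s : Set {e : Sym2 (Fin m) // ¬ e.IsDiag}) :
        (g s).edgeSet = Subtype.val '' s := by
      rw [SimpleGraph.edgeSet_fromEdgeSet, sdiff_eq_left, Set.disjoint_left]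
      rintro _ ⟨e, -, rfl⟩
      exact e.2
    rw [hdiff, hdiff] at h
    exact Subtype.val_injective.image_injective h
  calc 2 ^ m.choose 2 = Nat.card (Set {e : Sym2 (Fin m) // ¬ e.IsDiag}) := by
        rw [Nat.card_eq_fintype_card, Fintype.card_set, Sym2.card_subtype_not_diag,
          Fintype.card_fin]
    _ ≤ _ := Nat.card_le_card_of_injective g hg

/-- An isomorphism class of graphs on `m` nodes has at most `m!` members. -/
theorem card_simpleGraph_le (m : ℕ) :
    Nat.card (SimpleGraph (Fin m)) ≤ Nat.card (Quotient (isoSetoid m)) * m.factorial := by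
  classical
  let g : Quotient (isoSetoid m) × Equiv.Perm (Fin m) → SimpleGraph (Fin m) :=
    fun c => c.1.out.comap c.2
  have hg : Function.Surjective g := fun H => by
    obtain ⟨e⟩ := Quotient.mk_out (s := isoSetoid m) H
    refine ⟨(Quotient.mk _ H, e.symm.toEquiv), ?_⟩
    ext u v
    exact e.symm.map_adj_iff
  have : Finite (Quotient (isoSetoid m)) := Quotient.finite _
  calc Nat.card (SimpleGraph (Fin m))
      ≤ Nat.card (Quotient (isoSetoid m) × Equiv.Perm (Fin m)) :=
        Nat.card_le_card_of_surjective g hg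
    _ = _ := by rw [Nat.card_prod, Nat.card_perm, Nat.card_fin]

/-- There are enough isomorphism classes of graphs on `m ≥ n / 4` nodes to encode all `n`-bit
strings. -/
theorem exists_invariant_surjective {n m : ℕ} (hm : 16 ≤ m) (hnm : n ≤ 4 * m) :
    ∃ φ : SimpleGraph (Fin m) → (Fin n → Bool),
      (∀ H H', Nonempty (H ≃g H') → φ H = φ H') ∧ Function.Surjective φ := by
  classical
  have : Finite (Quotient (isoSetoid m)) := Quotient.finite _
  have hcard : 2 ^ n ≤ Nat.card (Quotient (isoSetoid m)) := by
    refine Nat.le_of_mul_le_mul_right ?_ m.factorial_pos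
    calc 2 ^ n * m.factorial ≤ 2 ^ (4 * m) * m.factorial := by gcongr; norm_num
      _ ≤ _ := (factorial_mul_le_two_pow_choose hm).trans
        ((two_pow_choose_le_card_simpleGraph m).trans (card_simpleGraph_le m))
  have := Fintype.ofFinite (Quotient (isoSetoid m))
  obtain ⟨emb⟩ : Nonempty ((Fin n → Bool) ↪ Quotient (isoSetoid m)) :=
    Function.Embedding.nonempty_of_card_le (by simpa using hcard)
  refine ⟨fun H => Function.invFun emb (Quotient.mk _ H),
    fun H H' h => congrArg _ (Quotient.sound h), ?_⟩
  exact (Function.invFun_surjective emb.injective).comp Quotient.mk_surjective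

theorem exists_gadgetEncoding : ∃ E : GadgetEncoding, Tendsto E.p atTop atTop ∧
    ∀ n, E.n₀ ≤ n → 4 ≤ E.p n ∧ hashBound (E.p n) ≤ n := by
  classical
  obtain ⟨n₀, hn₀⟩ := eventually_atTop.1
    ((tendsto_atTop.1 tendsto_pathLength 4).and (eventually_ge_atTop 64))
  let m : ℕ → ℕ := fun n => (n - pathLength n) / 2
  have hφ (n : ℕ) : ∃ φ : SimpleGraph (Fin (m n)) → (Fin n → Bool),
      (∀ H H', Nonempty (H ≃g H') → φ H = φ H') ∧ (n₀ ≤ n → Function.Surjective φ) := by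
    by_cases hn : n₀ ≤ n
    · have h1 := hn₀ n hn
      have h2 := two_mul_pathLength_le n
      have h3 := (pathLength_spec (n := n) (by omega)).1
      obtain ⟨φ, hiso, hsurj⟩ :=
        exists_invariant_surjective (n := n) (m := m n) (by grind) (by grind)
      exact ⟨φ, hiso, fun _ => hsurj⟩
    · exact ⟨fun _ _ => false, fun _ _ _ => rfl, fun h => absurd h hn⟩
  choose φ hiso hsurj using hφ
  refine ⟨⟨n₀, m, pathLength, fun n hn => ?_, fun n hn => ?_, φ, hiso, hsurj⟩,
    tendsto_pathLength, fun n hn => ⟨(hn₀ n hn).1, ?_⟩⟩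
  · have h1 := hn₀ n hn
    have h2 := two_mul_pathLength_le n
    have h3 := (pathLength_spec (n := n) (by omega)).1
    grind
  · exact le_trans (by norm_num) (hn₀ n hn).1
  · exact (pathLength_spec (by have := (hn₀ n hn).1; omega)).2

/-! ### Isomorphic gadget networks have isomorphic gadgets -/

/-- The distance to the first node of the path. -/
def distFirst {m p : ℕ} : GadgetVertex m p → ℕ
  | .alice _ => 1
  | .path i => i
  | .bob _ => p

/-- The distance to the last node of the path. -/
def distLast {m p : ℕ} : GadgetVertex m p → ℕ
  | .alice _ => p
  | .path i => p - 1 - i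
  | .bob _ => 1

theorem gadgetGraph_adj {m p : ℕ} {HA HB : SimpleGraph (Fin m)} {u v : GadgetVertex m p} :
    (gadgetGraph p HA HB).Adj u v ↔ gadgetAdj HA HB u v := Iff.rfl

section Distances

variable {m p : ℕ} {HA HB : SimpleGraph (Fin m)}

theorem distFirst_le_of_adj (u v : GadgetVertex m p) (h : gadgetAdj HA HB u v) :
    distFirst v ≤ distFirst u + 1 := by
  rcases u with i | i | i <;> rcases v with j | j | j <;>
    simp only [gadgetAdj, distFirst] at h ⊢ <;> omega

theorem distLast_le_of_adj (u v : GadgetVertex m p) (h : gadgetAdj HA HB u v) :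
    distLast v ≤ distLast u + 1 := by
  rcases u with i | i | i <;> rcases v with j | j | j <;>
    simp only [gadgetAdj, distLast] at h ⊢ <;> omega

theorem exists_adj_distFirst (hp : 0 < p) (u : GadgetVertex m p) {l : ℕ}
    (h : distFirst u = l + 1) : ∃ v, gadgetAdj HA HB u v ∧ distFirst v = l := by
  rcases u with i | i | i <;> simp only [distFirst] at h
  · exact ⟨.path ⟨0, hp⟩, rfl, by simp only [distFirst]; omega⟩
  · exact ⟨.path ⟨l, by omega⟩, by simp only [gadgetAdj]; omega, rfl⟩
  · exact ⟨.path ⟨l, by omega⟩, by simp only [gadgetAdj]; omega, rfl⟩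

theorem exists_adj_distLast (hp : 0 < p) (u : GadgetVertex m p) {l : ℕ}
    (h : distLast u = l + 1) : ∃ v, gadgetAdj HA HB u v ∧ distLast v = l := by
  rcases u with i | i | i <;> simp only [distLast] at h
  · exact ⟨.path ⟨0, hp⟩, rfl, by simp only [distLast]; omega⟩
  · exact ⟨.path ⟨i + 1, by omega⟩, Or.inl rfl,
      by simp only [distLast]; omega⟩
  · exact ⟨.path ⟨p - 1, by omega⟩, by simp only [gadgetAdj]; omega,
      by simp only [distLast]; omega⟩

theorem distFirst_eq_zero_iff (hp : 2 ≤ p) (u : GadgetVertex m p) :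
    distFirst u = 0 ↔ gadgetInput u = [false] := by
  rcases u with i | i | i <;> simp only [distFirst, gadgetInput]
  · simp
  · split_ifs <;> simp [*]
  · simp; omega

theorem distLast_eq_zero_iff (hp : 2 ≤ p) (u : GadgetVertex m p) :
    distLast u = 0 ↔ gadgetInput u = [true] := by
  rcases u with i | i | i <;> simp only [distLast, gadgetInput]
  · simp; omega
  · split_ifs <;> simp <;> omega
  · simp

theorem distLast_eq_iff (hp : 2 ≤ p) (u : GadgetVertex m p) :
    distLast u = p ↔ ∃ i, u = .alice i := by
  rcases u with i | i | i <;> simp [distLast] <;> omega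

theorem distFirst_eq_iff (hp : 2 ≤ p) (u : GadgetVertex m p) :
    distFirst u = p ↔ ∃ i, u = .bob i := by
  rcases u with i | i | i <;> simp [distFirst] <;> omega

end Distances

/-- A map of graphs that respects the roots does not increase distances to the roots: `d` is a
function that decreases along some edge wherever it is positive, and `d'` one that changes by at
most one along an edge. -/
theorem level_map_le {V V' : Type*} {R : V → V → Prop} {R' : V' → V' → Prop} (e : V → V')
    (he : ∀ u v, R u v → R' (e u) (e v)) {d : V → ℕ} {d' : V' → ℕ}
    (hroot : ∀ u, d u = 0 → d' (e u) = 0)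
    (hdesc : ∀ u l, d u = l + 1 → ∃ v, R u v ∧ d v = l)
    (hlip : ∀ u v, R' u v → d' u ≤ d' v + 1) (u : V) : d' (e u) ≤ d u := by
  generalize hl : d u = l
  induction l generalizing u with
  | zero => exact (hroot u hl).le
  | succ l ih =>
    obtain ⟨v, huv, hv⟩ := hdesc u l hl
    exact (hlip _ _ (he _ _ huv)).trans (Nat.succ_le_succ (ih v hv))

section GadgetIso

variable {m p : ℕ} {HA HB HA' HB' : SimpleGraph (Fin m)}

theorem distLast_map_le (hp : 2 ≤ p) (e : gadgetGraph p HA HB ≃g gadgetGraph p HA' HB')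
    (he : ∀ v, gadgetInput (e v) = gadgetInput v) (u) : distLast (e u) ≤ distLast u :=
  level_map_le e (fun _ _ h => e.map_adj_iff.2 h)
    (fun u hu => by rwa [distLast_eq_zero_iff hp, he, ← distLast_eq_zero_iff hp])
    (fun u _ hl => exists_adj_distLast (by omega) u hl)
    (fun u v h => distLast_le_of_adj v u (SimpleGraph.Adj.symm (G := gadgetGraph p HA' HB') h)) u

theorem distFirst_map_le (hp : 2 ≤ p) (e : gadgetGraph p HA HB ≃g gadgetGraph p HA' HB')
    (he : ∀ v, gadgetInput (e v) = gadgetInput v) (u) : distFirst (e u) ≤ distFirst u :=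
  level_map_le e (fun _ _ h => e.map_adj_iff.2 h)
    (fun u hu => by rwa [distFirst_eq_zero_iff hp, he, ← distFirst_eq_zero_iff hp])
    (fun u _ hl => exists_adj_distFirst (by omega) u hl)
    (fun u v h => distFirst_le_of_adj v u (SimpleGraph.Adj.symm (G := gadgetGraph p HA' HB') h)) u

theorem nonempty_iso_of_forall_exists {V : Type*} {G G' : SimpleGraph V} (e : G ≃g G')
    {H H' : SimpleGraph (Fin m)} {ι : Fin m → V} (hι : Function.Injective ι)
    (hH : ∀ i j, G.Adj (ι i) (ι j) ↔ H.Adj i j) (hH' : ∀ i j, G'.Adj (ι i) (ι j) ↔ H'.Adj i j)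
    (h : ∀ i, ∃ j, e (ι i) = ι j) : Nonempty (H ≃g H') := by
  choose t ht using h
  have hinj : Function.Injective t := fun i j hij =>
    hι (e.injective (by rw [ht, ht, hij]))
  exact ⟨⟨Equiv.ofBijective t (Finite.injective_iff_bijective.1 hinj), fun {i j} => by
    rw [← hH, ← e.map_adj_iff, ht, ht, hH']; rfl⟩⟩

/-- The gadgets can be recognised in the network: Alice's gadget consists of the nodes at distance
`p` from the last node of the path, and Bob's gadget of those at distance `p` from the first one. -/
theorem nonempty_iso_of_gadgetGraph_iso (hp : 2 ≤ p)
    (e : gadgetGraph p HA HB ≃g gadgetGraph p HA' HB')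
    (he : ∀ v, gadgetInput (e v) = gadgetInput v) :
    Nonempty (HA ≃g HA') ∧ Nonempty (HB ≃g HB') := by
  have he' : ∀ v, gadgetInput (e.symm v) = gadgetInput v := fun v => by
    rw [← he, e.apply_symm_apply]
  have hlast (u) : distLast (e u) = distLast u :=
    (distLast_map_le hp e he u).antisymm (by simpa using distLast_map_le hp e.symm he' (e u))
  have hfirst (u) : distFirst (e u) = distFirst u :=
    (distFirst_map_le hp e he u).antisymm (by simpa using distFirst_map_le hp e.symm he' (e u))
  constructor
  · exact nonempty_iso_of_forall_exists (ι := GadgetVertex.alice) e (fun i j h => by simpa using h)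
      (fun _ _ => Iff.rfl) (fun _ _ => Iff.rfl)
      fun i => (distLast_eq_iff hp _).1 ((hlast _).trans ((distLast_eq_iff hp _).2 ⟨i, rfl⟩))
  · exact nonempty_iso_of_forall_exists (ι := GadgetVertex.bob) e (fun i j h => by simpa using h)
      (fun _ _ => Iff.rfl) (fun _ _ => Iff.rfl)
      fun i => (distFirst_eq_iff hp _).1 ((hfirst _).trans ((distFirst_eq_iff hp _).2 ⟨i, rfl⟩))

end GadgetIso

/-- The encoded strings do not depend on the presentation of a network as a gadget network. -/
theorem GadgetEncoding.φ_eq_of_iso (E : GadgetEncoding) {G : LabeledGraph} (hn : E.n₀ ≤ G.order)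
    {HA HB HA' HB' : SimpleGraph (Fin (E.m G.order))}
    (e : G.graph ≃g gadgetGraph (E.p G.order) HA HB)
    (e' : G.graph ≃g gadgetGraph (E.p G.order) HA' HB')
    (hnode : ∀ v, G.nodeInput v = gadgetInput (e v))
    (hnode' : ∀ v, G.nodeInput v = gadgetInput (e' v)) :
    E.φ G.order HA = E.φ G.order HA' ∧ E.φ G.order HB = E.φ G.order HB' := by
  obtain ⟨h1, h2⟩ := nonempty_iso_of_gadgetGraph_iso (E.two_le_p _ hn) (e.symm.trans e')
    fun v => by
      simp only [RelIso.trans_apply]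
      rw [← hnode', hnode, RelIso.apply_symm_apply]
  exact ⟨E.φ_iso _ _ _ h1, E.φ_iso _ _ _ h2⟩

theorem mem_gadgetLanguage_iff {E : GadgetEncoding} {f : BooleanFunction} {G : LabeledGraph}
    (hn : E.n₀ ≤ G.order) {HA HB : SimpleGraph (Fin (E.m G.order))}
    (e : G.graph ≃g gadgetGraph (E.p G.order) HA HB)
    (hnode : ∀ v, G.nodeInput v = gadgetInput (e v)) (hedge : ∀ d, G.edgeInput d = []) :
    G ∈ gadgetLanguage E f ↔ f G.order (E.φ G.order HA) (E.φ G.order HB) = true := by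
  refine ⟨?_, fun h => ⟨hn, HA, HB, e, hnode, hedge, h⟩⟩
  rintro ⟨-, HA', HB', e', hnode', -, h⟩
  obtain ⟨h1, h2⟩ := E.φ_eq_of_iso hn e e' hnode hnode'
  rwa [h1, h2]

/-! ### From verification to communication -/

/-- The nodes of a gadget network as a sum type. -/
def gadgetVertexEquiv (m p : ℕ) : GadgetVertex m p ≃ Fin m ⊕ Fin p ⊕ Fin m where
  toFun
    | .alice i => .inl i
    | .path i => .inr (.inl i)
    | .bob i => .inr (.inr i)
  invFun
    | .inl i => .alice i
    | .inr (.inl i) => .path i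
    | .inr (.inr i) => .bob i
  left_inv := by rintro (i | i | i) <;> rfl
  right_inv := by rintro (i | i | i) <;> rfl

theorem nonempty_fin_equiv_gadgetVertex {n m p : ℕ} (h : 2 * m + p = n) :
    Nonempty (Fin n ≃ GadgetVertex m p) := by
  refine ⟨Equiv.trans (Fintype.equivOfCardEq ?_) (gadgetVertexEquiv m p).symm⟩
  simp only [Fintype.card_fin, Fintype.card_sum]
  omega

/-- The gadget network on the nodes `0, …, n - 1`, numbered by `σ`. -/
def gadgetNetwork {n m p : ℕ} (hn : 0 < n) (σ : Fin n ≃ GadgetVertex m p)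
    (HA HB : SimpleGraph (Fin m)) : LabeledGraph where
  order := n
  order_pos := hn
  graph := (gadgetGraph p HA HB).comap σ
  nodeInput v := gadgetInput (σ v)
  edgeInput _ := []

section Locality

variable {n m p : ℕ} (hn : 0 < n) (σ : Fin n ≃ GadgetVertex m p)
  {HA HB HA' HB' : SimpleGraph (Fin m)} {d : GadgetVertex m p → ℕ} {c r : ℕ}

/-- A ball stays within the sublevel set `{d ≤ c}` when `d` grows by at most one along an edge. -/
theorem le_and_mem_ball_of_mem_ball
    (hd : ∀ u v, gadgetAdj HA HB u v → d v ≤ d u + 1)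
    (hagree : ∀ u v, d u ≤ c → d v ≤ c → (gadgetAdj HA HB u v ↔ gadgetAdj HA' HB' u v))
    {v u : Fin n} (hv : d (σ v) + r ≤ c) (hu : u ∈ ball (gadgetNetwork hn σ HA HB) r v) :
    d (σ u) ≤ c ∧ u ∈ ball (gadgetNetwork hn σ HA' HB') r v := by
  obtain ⟨q, hq⟩ := hu
  suffices h : ∀ (v u : Fin n) (q : (gadgetNetwork hn σ HA HB).graph.Walk v u),
      d (σ v) + q.length ≤ c → d (σ u) ≤ c ∧
        ∃ q' : (gadgetNetwork hn σ HA' HB').graph.Walk v u, q'.length = q.length by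
    obtain ⟨h1, q', h2⟩ := h v u q (by omega)
    exact ⟨h1, q', by omega⟩
  intro v u q
  induction q with
  | nil => exact fun h => ⟨h, .nil, rfl⟩
  | @cons v w u hvw q ih =>
    intro h
    change d (σ v) + (q.length + 1) ≤ c at h
    have hw : d (σ w) ≤ d (σ v) + 1 := hd _ _ hvw
    obtain ⟨h1, q', h2⟩ := ih (by change d (σ w) + q.length ≤ c; omega)
    have hvw' : (gadgetNetwork hn σ HA' HB').graph.Adj v w :=
      (hagree _ _ (by omega) (by omega)).1 hvw
    exact ⟨h1, .cons hvw' q', congrArg Nat.succ h2⟩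

/-- Views agree in two gadget networks that agree on a sublevel set containing the ball. -/
theorem view_gadgetNetwork_congr
    (hd : ∀ u v, gadgetAdj HA HB u v → d v ≤ d u + 1)
    (hd' : ∀ u v, gadgetAdj HA' HB' u v → d v ≤ d u + 1)
    (hagree : ∀ u v, d u ≤ c → d v ≤ c → (gadgetAdj HA HB u v ↔ gadgetAdj HA' HB' u v))
    (id : Fin n → ℕ) {v : Fin n} (hv : d (σ v) + r ≤ c) :
    view (gadgetNetwork hn σ HA HB) id r v = view (gadgetNetwork hn σ HA' HB') id r v := by
  have hagree' : ∀ u v, d u ≤ c → d v ≤ c → (gadgetAdj HA' HB' u v ↔ gadgetAdj HA HB u v) :=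
    fun u v hu hv => (hagree u v hu hv).symm
  have hball : ball (gadgetNetwork hn σ HA HB) r v = ball (gadgetNetwork hn σ HA' HB') r v :=
    Set.ext fun u => ⟨fun hu => (le_and_mem_ball_of_mem_ball hn σ hd hagree hv hu).2,
      fun hu => (le_and_mem_ball_of_mem_ball hn σ hd' hagree' hv hu).2⟩
  have hle (u) (hu : u ∈ ball (gadgetNetwork hn σ HA HB) r v) : d (σ u) ≤ c :=
    (le_and_mem_ball_of_mem_ball hn σ hd hagree hv hu).1
  unfold view
  rw [← hball]
  congr 1
  ext a
  constructor
  · rintro ⟨u, hu, w, hw, h, rfl⟩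
    exact ⟨u, hu, w, hw, (hagree _ _ (hle u hu) (hle w hw)).1 h, rfl⟩
  · rintro ⟨u, hu, w, hw, h, rfl⟩
    exact ⟨u, hu, w, hw, (hagree _ _ (hle u hu) (hle w hw)).2 h, rfl⟩

/-- The nodes far from Bob's gadget do not see it. -/
theorem view_gadgetNetwork_of_distFirst (id : Fin n → ℕ) {v : Fin n}
    (hv : distFirst (σ v) + r < p) :
    view (gadgetNetwork hn σ HA HB) id r v = view (gadgetNetwork hn σ HA HB') id r v := by
  refine view_gadgetNetwork_congr hn σ (d := distFirst) (c := p - 1) distFirst_le_of_adj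
    distFirst_le_of_adj ?_ id (by omega)
  rintro (i | i | i) (j | j | j) h1 h2 <;> simp only [distFirst] at h1 h2 <;>
    first | exact Iff.rfl | omega

/-- The nodes far from Alice's gadget do not see it. -/
theorem view_gadgetNetwork_of_distLast (id : Fin n → ℕ) {v : Fin n}
    (hv : distLast (σ v) + r < p) :
    view (gadgetNetwork hn σ HA HB) id r v = view (gadgetNetwork hn σ HA' HB) id r v := by
  refine view_gadgetNetwork_congr hn σ (d := distLast) (c := p - 1) distLast_le_of_adj
    distLast_le_of_adj ?_ id (by omega)
  rintro (i | i | i) (j | j | j) h1 h2 <;> simp only [distLast] at h1 h2 <;>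
    first | exact Iff.rfl | omega

end Locality

/-- If the radius is small compared with the path, Alice simulates the nodes that do not see Bob's
gadget, and Bob those that do not see Alice's. -/
theorem exists_simulation {E : GadgetEncoding} {f : BooleanFunction} {ρ : ℕ → ℕ} {r : ℕ}
    {V : Verifier} {s : ℕ → ℕ} {k : ℕ} {a : Player} (hρ : ∀ N, N ≤ ρ N)
    (hV : DecidesGlobal ρ r V s k a (gadgetLanguage E f)) {n : ℕ} (hn : E.n₀ ≤ n)
    (hr : 2 * r + 2 ≤ E.p n) :
    ∃ A B : List (List Bool) → (Fin n → Bool) → Bool, ∀ x y,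
      Alternates (s n) k a (fun ls => A ls x = true ∧ B ls y = true) ↔ f n x y = true := by
  classical
  have hsize := E.size_eq n hn
  have hpos : 0 < n := by omega
  obtain ⟨σ⟩ := nonempty_fin_equiv_gadgetVertex hsize
  choose H hH using E.φ_surjective n hn
  refine ⟨fun ls x => decide (∀ v : Fin n, distFirst (σ v) + r < E.p n →
      V (view (gadgetNetwork hpos σ (H x) ⊥) Fin.val r v) ls = true),
    fun ls y => decide (∀ v : Fin n, distLast (σ v) + r < E.p n →
      V (view (gadgetNetwork hpos σ ⊥ (H y)) Fin.val r v) ls = true), fun x y => ?_⟩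
  have key := hV (gadgetNetwork hpos σ (H x) (H y)) Fin.val
    ⟨Fin.val_injective, fun v => v.2.trans_le (hρ n)⟩
  rw [mem_gadgetLanguage_iff (HA := H x) (HB := H y) hn (SimpleGraph.Iso.comap σ _) (fun _ => rfl)
    (fun _ => rfl)] at key
  change f n (E.φ n (H x)) (E.φ n (H y)) = true ↔ _ at key
  rw [hH, hH] at key
  rw [key]
  refine alternates_congr fun ls _ _ => ?_
  simp only [decide_eq_true_eq]
  constructor
  · rintro ⟨hA, hB⟩ v
    have hside : distFirst (σ v) + r < E.p n ∨ distLast (σ v) + r < E.p n := by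
      rcases σ v with i | i | i <;> simp only [distFirst, distLast] <;> omega
    rcases hside with h | h
    · exact (congrArg (V · ls) (view_gadgetNetwork_of_distFirst hpos σ _ h)).trans (hA v h)
    · exact (congrArg (V · ls) (view_gadgetNetwork_of_distLast hpos σ _ h)).trans (hB v h)
  · intro h
    refine ⟨fun v hv => ?_, fun v hv => ?_⟩
    · exact (congrArg (V · ls) (view_gadgetNetwork_of_distFirst hpos σ _ hv)).trans (h v)
    · exact (congrArg (V · ls) (view_gadgetNetwork_of_distLast hpos σ _ hv)).trans (h v)

/-- With `n` bits per advice string the prover, who moves last, can tell Bob the input of Alice. -/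
theorem exists_trivial_protocol {n : ℕ} (F : (Fin n → Bool) → (Fin n → Bool) → Bool) {k : ℕ}
    (hk : 1 ≤ k) :
    ∃ A B : List (List Bool) → (Fin n → Bool) → Bool, ∀ x y,
      Alternates n k (starter k) (fun ls => A ls x = true ∧ B ls y = true) ↔ F x y = true := by
  classical
  obtain ⟨k, rfl⟩ : ∃ j, k = j + 1 := ⟨k - 1, by omega⟩
  refine ⟨fun ls x => decide (ls.getLast? = some (List.ofFn x)),
    fun ls y => decide (∃ x, ls.getLast? = some (List.ofFn x) ∧ F x y = true), fun x y => ?_⟩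
  rw [alternates_starter_succ]
  simp only [List.getLast?_append, List.getLast?_singleton, Option.some_or, Option.some.injEq,
    decide_eq_true_eq]
  rw [alternates_const]
  constructor
  · rintro ⟨l, -, rfl, x', hx', h⟩
    rwa [List.ofFn_injective hx']
  · exact fun h => ⟨_, List.length_ofFn, rfl, x, rfl, h⟩

theorem mem_ccClass_of_mem_globalClass {E : GadgetEncoding} (hp : Tendsto E.p atTop atTop)
    {f : BooleanFunction} {ρ : ℕ → ℕ} (hρ : ∀ N, N ≤ ρ N) {g : ℕ → ℝ} {k : ℕ} (hk : 1 ≤ k)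
    (h : gadgetLanguage E f ∈ globalClass ρ (starter k) k g) : f ∈ ccClass (starter k) k g := by
  obtain ⟨s, r, V, hs, hV⟩ := h
  have hn (n : ℕ) : ∃ (t : ℕ) (A B : List (List Bool) → (Fin n → Bool) → Bool),
      (E.n₀ ≤ n → 2 * r + 2 ≤ E.p n → t = s n) ∧ ∀ x y,
        Alternates t k (starter k) (fun ls => A ls x = true ∧ B ls y = true) ↔ f n x y = true := by
    by_cases hn : E.n₀ ≤ n ∧ 2 * r + 2 ≤ E.p n
    · obtain ⟨A, B, hAB⟩ := exists_simulation hρ hV hn.1 hn.2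
      exact ⟨s n, A, B, fun _ _ => rfl, hAB⟩
    · obtain ⟨A, B, hAB⟩ := exists_trivial_protocol (f n) hk
      exact ⟨n, A, B, fun h1 h2 => absurd ⟨h1, h2⟩ hn, hAB⟩
  choose t A B ht hAB using hn
  refine ⟨t, A, B, hs.congr' ?_ EventuallyEq.rfl, hAB⟩
  filter_upwards [eventually_ge_atTop E.n₀, tendsto_atTop.1 hp (2 * r + 2)] with n h1 h2
  rw [ht n h1 h2]

/-! ### Views of radius one -/

/-- Adjacency, as seen in a view; nodes are named by their identifiers. -/
def View.Adj (V : View) (x y : ℕ) : Prop := ∃ l, (x, y, l) ∈ V.edges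

section ViewOne

variable {G : LabeledGraph} {id : Fin G.order → ℕ} {u v w : Fin G.order}

theorem mem_ball_one_iff : u ∈ ball G 1 v ↔ u = v ∨ G.graph.Adj v u := by
  constructor
  · rintro ⟨q, hq⟩
    match q, hq with
    | .nil, _ => exact .inl rfl
    | .cons h .nil, _ => exact .inr h
  · rintro (rfl | h)
    · exact ⟨.nil, by simp⟩
    · exact ⟨.cons h .nil, by simp⟩

theorem view_one_adj_iff (hid : Function.Injective id) :
    (view G id 1 v).Adj (id u) (id w) ↔
      (u = v ∨ G.graph.Adj v u) ∧ (w = v ∨ G.graph.Adj v w) ∧ G.graph.Adj u w := by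
  constructor
  · rintro ⟨l, u', hu', w', hw', h, heq⟩
    simp only [Prod.mk.injEq] at heq
    obtain rfl := hid heq.1
    obtain rfl := hid heq.2.1
    exact ⟨mem_ball_one_iff.1 hu', mem_ball_one_iff.1 hw', h⟩
  · rintro ⟨hu, hw, h⟩
    exact ⟨_, u, mem_ball_one_iff.2 hu, w, mem_ball_one_iff.2 hw, h, rfl⟩

theorem exists_of_view_adj {r x y : ℕ} (h : (view G id r v).Adj x y) :
    ∃ u w, id u = x ∧ id w = y := by
  obtain ⟨l, u, -, w, -, hadj, heq⟩ := h
  simp only [Prod.mk.injEq] at heq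
  exact ⟨u, w, heq.1.symm, heq.2.1.symm⟩

theorem view_one_center_adj_iff (hid : Function.Injective id) {y : ℕ} :
    (view G id 1 v).Adj (id v) y ↔ ∃ w, G.graph.Adj v w ∧ id w = y := by
  constructor
  · intro h
    obtain ⟨-, w, -, rfl⟩ := exists_of_view_adj h
    exact ⟨w, ((view_one_adj_iff hid).1 h).2.2, rfl⟩
  · rintro ⟨w, hw, rfl⟩
    exact (view_one_adj_iff hid).2 ⟨.inl rfl, .inr hw, hw⟩

theorem mem_view_nodes_iff (hid : Function.Injective id) {r : ℕ} {l : List Bool} :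
    (id v, l) ∈ (view G id r v).nodes ↔ G.nodeInput v = l := by
  constructor
  · rintro ⟨u, -, heq⟩
    simp only [Prod.mk.injEq] at heq
    obtain rfl := hid heq.1
    exact heq.2.symm
  · rintro rfl
    exact ⟨v, ⟨.nil, by simp⟩, rfl⟩

end ViewOne

/-! ### Local conditions that characterise gadget networks -/

/-- What the nodes have to know about a gadget network: its size, the identifiers of the two nodes
at either end of the path, and a function that sends the identifiers of the path nodes to their
positions (the other identifiers are sent anywhere). -/
structure Layout where
  size : ℕ
  /-- the first node of the path, joined to Alice's gadget -/
  endA : ℕ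
  /-- the second node of the path -/
  nextA : ℕ
  /-- the last node of the path, joined to Bob's gadget -/
  endB : ℕ
  /-- the last node of the path but one -/
  nextB : ℕ
  pos : ℕ → ℕ

/-- The positions of the named nodes are the right ones for a path on `p` nodes. -/
structure Layout.IsCoherent (D : Layout) (p : ℕ) : Prop where
  pos_endA : D.pos D.endA = 0
  pos_nextA : D.pos D.nextA = 1
  pos_endB : D.pos D.endB + 1 = p
  pos_nextB : D.pos D.nextB + 2 = p
  four_le : 4 ≤ p

/-- The view of a node of the gadget joined to the end `e` of the path: all its neighbours are
`e` and other neighbours of `e`. Here `e'` is the path node next to `e`, and `o`, `o'` are their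
counterparts at the other end. -/
structure IsGadgetView (V : View) (e e' o o' : ℕ) : Prop where
  input : (V.center, []) ∈ V.nodes
  ne_end : V.center ≠ e
  ne_next : V.center ≠ e'
  ne_end' : V.center ≠ o
  ne_next' : V.center ≠ o'
  adj_end : V.Adj V.center e
  not_adj_end' : ¬ V.Adj V.center o
  closed : ∀ y, V.Adj V.center y → y = e ∨ y ≠ e' ∧ V.Adj y e

/-- The view of the end `e` of the path: apart from the next path node `e'`, the neighbours
`h 0, …, h (m - 1)` of `e` form a copy of `H`. The identifiers `o`, `o'` are those of the last two
nodes at the other end. -/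
structure IsEndView (V : View) (mark : Bool) (e e' o o' : ℕ) {m : ℕ} (H : SimpleGraph (Fin m))
    (h : Fin m → ℕ) : Prop where
  center_eq : V.center = e
  input : (V.center, [mark]) ∈ V.nodes
  injective : Function.Injective h
  ne_next : ∀ i, h i ≠ e'
  ne_end' : ∀ i, h i ≠ o
  ne_next' : ∀ i, h i ≠ o'
  adj_iff : ∀ y, V.Adj V.center y ↔ y = e' ∨ ∃ i, h i = y
  gadget_adj_iff : ∀ i j, V.Adj (h i) (h j) ↔ H.Adj i j

/-- The view of an inner node of the path: it has exactly two neighbours, and they have the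
preceding and the following position. -/
structure IsInnerView (V : View) (D : Layout) (p : ℕ) : Prop where
  input : (V.center, []) ∈ V.nodes
  ne_endA : V.center ≠ D.endA
  ne_endB : V.center ≠ D.endB
  pos_pos : 0 < D.pos V.center
  pos_lt : D.pos V.center + 1 < p
  eq_nextA : V.Adj V.center D.endA → V.center = D.nextA
  eq_nextB : V.Adj V.center D.endB → V.center = D.nextB
  exists_adj : ∃ y z, V.Adj V.center y ∧ V.Adj V.center z ∧ D.pos y + 1 = D.pos V.center ∧
    D.pos z = D.pos V.center + 1 ∧ ∀ w, V.Adj V.center w → w = y ∨ w = z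

/-- The view fits a network with the layout `D` whose gadgets, on `m` nodes, have the properties
`ΦA` and `ΦB`, and whose path has `p` nodes. -/
structure IsLocallyValid (V : View) (D : Layout) (p m : ℕ) (ΦA ΦB : SimpleGraph (Fin m) → Prop) :
    Prop where
  coherent : D.IsCoherent p
  edge_input : ∀ x y l, (x, y, l) ∈ V.edges → l = []
  kind : IsGadgetView V D.endA D.nextA D.endB D.nextB ∨
    IsGadgetView V D.endB D.nextB D.endA D.nextA ∨
    (∃ H h, IsEndView V false D.endA D.nextA D.endB D.nextB (m := m) H h ∧ ΦA H) ∨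
    (∃ H h, IsEndView V true D.endB D.nextB D.endA D.nextA (m := m) H h ∧ ΦB H) ∨
    IsInnerView V D p

/-- `D` is the layout of the gadget network whose node `u` has the identifier `ν u`. -/
structure Layout.Describes (D : Layout) {m p : ℕ} (ν : GadgetVertex m p → ℕ) : Prop where
  endA : ∀ i : Fin p, (i : ℕ) = 0 → D.endA = ν (.path i)
  nextA : ∀ i : Fin p, (i : ℕ) = 1 → D.nextA = ν (.path i)
  endB : ∀ i : Fin p, (i : ℕ) + 1 = p → D.endB = ν (.path i)
  nextB : ∀ i : Fin p, (i : ℕ) + 2 = p → D.nextB = ν (.path i)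
  pos : ∀ i, D.pos (ν (.path i)) = i

section Completeness

variable {G : LabeledGraph} {id : Fin G.order → ℕ} {m p : ℕ} {HA HB : SimpleGraph (Fin m)}
  {D : Layout}

theorem Layout.Describes.isCoherent {ν : GadgetVertex m p → ℕ} (hD : D.Describes ν) (hp : 4 ≤ p) :
    D.IsCoherent p where
  pos_endA := by rw [hD.endA ⟨0, by omega⟩ rfl, hD.pos]
  pos_nextA := by rw [hD.nextA ⟨1, by omega⟩ rfl, hD.pos]
  pos_endB := by rw [hD.endB ⟨p - 1, by omega⟩ (by simp; omega), hD.pos]; simp; omega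
  pos_nextB := by rw [hD.nextB ⟨p - 2, by omega⟩ (by simp; omega), hD.pos]; simp; omega
  four_le := hp

/-- Gadget networks satisfy the local conditions. -/
theorem isLocallyValid_view (hid : Function.Injective id)
    (e : G.graph ≃g gadgetGraph p HA HB) (hnode : ∀ v, G.nodeInput v = gadgetInput (e v))
    (hedge : ∀ d, G.edgeInput d = []) (hp : 4 ≤ p)
    (hD : D.Describes (fun u => id (e.symm u))) {ΦA ΦB : SimpleGraph (Fin m) → Prop}
    (hA : ΦA HA) (hB : ΦB HB) (v : Fin G.order) :
    IsLocallyValid (view G id 1 v) D p m ΦA ΦB := by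
  refine ⟨hD.isCoherent hp, ?_, ?_⟩
  · rintro x y l ⟨u, -, w, -, h, heq⟩
    simp only [Prod.mk.injEq] at heq
    rw [heq.2.2, hedge]
  obtain ⟨u, rfl⟩ := e.symm.surjective v
  set ν : GadgetVertex m p → ℕ := fun u => id (e.symm u) with hν
  have hinj : Function.Injective ν := hid.comp e.symm.injective
  set V := view G id 1 (e.symm u) with hV
  have hcenter : V.center = ν u := rfl
  have hadj (s t) : V.Adj (ν s) (ν t) ↔
      (s = u ∨ gadgetAdj HA HB u s) ∧ (t = u ∨ gadgetAdj HA HB u t) ∧ gadgetAdj HA HB s t := by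
    rw [hV, view_one_adj_iff hid]
    simp only [e.symm.map_adj_iff, e.symm.injective.eq_iff, gadgetGraph_adj]
  have hcadj (t) : V.Adj (ν u) (ν t) ↔ gadgetAdj HA HB u t := by
    rw [hadj]; tauto
  have hex (y) (h : V.Adj (ν u) y) : ∃ t, gadgetAdj HA HB u t ∧ ν t = y := by
    obtain ⟨-, w, -, rfl⟩ := exists_of_view_adj h
    obtain ⟨t, rfl⟩ := e.symm.surjective w
    exact ⟨t, (hcadj t).1 h, rfl⟩
  have hinput (l) : (V.center, l) ∈ V.nodes ↔ gadgetInput u = l := by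
    rw [hV, show (view G id 1 (e.symm u)).center = id (e.symm u) from rfl,
      mem_view_nodes_iff hid, hnode, e.apply_symm_apply]
  have hendA := hD.endA ⟨0, by omega⟩ rfl
  have hnextA := hD.nextA ⟨1, by omega⟩ rfl
  have hendB := hD.endB ⟨p - 1, by omega⟩ (by simp; omega)
  have hnextB := hD.nextB ⟨p - 2, by omega⟩ (by simp; omega)
  rcases u with i | i | i
  · left
    constructor
    · rw [hinput]; rfl
    · rw [hcenter, hendA, hinj.ne_iff]; simp
    · rw [hcenter, hnextA, hinj.ne_iff]; simp
    · rw [hcenter, hendB, hinj.ne_iff]; simp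
    · rw [hcenter, hnextB, hinj.ne_iff]; simp
    · rw [hcenter, hendA, hcadj]; rfl
    · rw [hcenter, hendB, hcadj]; simp only [gadgetAdj]; omega
    · intro y hy
      obtain ⟨t, ht, rfl⟩ := hex y hy
      rw [hendA, hnextA, hinj.eq_iff, hinj.ne_iff, hadj]
      rcases t with j | j | j
      · exact .inr ⟨by simp, .inr ht, .inr rfl, rfl⟩
      · exact .inl (congrArg _ (Fin.ext ht))
      · exact ht.elim
  · by_cases h0 : (i : ℕ) = 0
    · right; right; left
      refine ⟨HA, fun j => ν (.alice j), ?_, hA⟩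
      constructor
      · rw [hcenter, hD.endA i h0]
      · rw [hinput]; simp [gadgetInput, h0]
      · exact fun j k h => by simpa using hinj h
      · intro j; rw [hnextA, hinj.ne_iff]; simp
      · intro j; rw [hendB, hinj.ne_iff]; simp
      · intro j; rw [hnextB, hinj.ne_iff]; simp
      · intro y
        constructor
        · intro hy
          obtain ⟨t, ht, rfl⟩ := hex y hy
          rcases t with j | j | j
          · exact .inr ⟨j, rfl⟩
          · refine .inl ((hD.nextA j ?_).symm)
            simp only [gadgetAdj] at ht; omega
          · simp only [gadgetAdj] at ht; omega
        · rintro (rfl | ⟨j, rfl⟩)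
          · rw [hcenter, hnextA, hcadj]; simp only [gadgetAdj]; omega
          · rw [hcenter, hcadj]; exact h0
      · intro j k
        rw [hadj]
        exact ⟨fun h => h.2.2, fun h => ⟨.inr h0, .inr h0, h⟩⟩
    by_cases hl : (i : ℕ) + 1 = p
    · right; right; right; left
      refine ⟨HB, fun j => ν (.bob j), ?_, hB⟩
      constructor
      · rw [hcenter, hD.endB i hl]
      · rw [hinput]; simp [gadgetInput, h0, hl]
      · exact fun j k h => by simpa using hinj h
      · intro j; rw [hnextB, hinj.ne_iff]; simp
      · intro j; rw [hendA, hinj.ne_iff]; simp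
      · intro j; rw [hnextA, hinj.ne_iff]; simp
      · intro y
        constructor
        · intro hy
          obtain ⟨t, ht, rfl⟩ := hex y hy
          rcases t with j | j | j
          · simp only [gadgetAdj] at ht; omega
          · refine .inl ((hD.nextB j ?_).symm)
            simp only [gadgetAdj] at ht; omega
          · exact .inr ⟨j, rfl⟩
        · rintro (rfl | ⟨j, rfl⟩)
          · rw [hcenter, hnextB, hcadj]; simp only [gadgetAdj]; omega
          · rw [hcenter, hcadj]; exact hl
      · intro j k
        rw [hadj]
        exact ⟨fun h => h.2.2, fun h => ⟨.inr hl, .inr hl, h⟩⟩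
    right; right; right; right
    have hlt := i.2
    constructor
    · rw [hinput]; simp [gadgetInput, h0, hl]
    · rw [hcenter, hendA, hinj.ne_iff]
      simpa [Fin.ext_iff] using h0
    · rw [hcenter, hendB, hinj.ne_iff, ne_eq, GadgetVertex.path.injEq, Fin.ext_iff]
      simp only; omega
    · rw [hcenter, hD.pos]; omega
    · rw [hcenter, hD.pos]; omega
    · rw [hcenter, hendA, hcadj]
      intro h
      refine (hD.nextA i ?_).symm
      simp only [gadgetAdj] at h; omega
    · rw [hcenter, hendB, hcadj]
      intro h
      refine (hD.nextB i ?_).symm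
      simp only [gadgetAdj] at h; omega
    · refine ⟨ν (.path ⟨i - 1, by omega⟩), ν (.path ⟨i + 1, by omega⟩), ?_, ?_, ?_, ?_, ?_⟩
      · rw [hcenter, hcadj]; simp only [gadgetAdj]; omega
      · rw [hcenter, hcadj]; exact .inl rfl
      · rw [hcenter, hD.pos, hD.pos]; simp only; omega
      · rw [hcenter, hD.pos, hD.pos]
      · intro y hy
        obtain ⟨t, ht, rfl⟩ := hex y hy
        rw [hinj.eq_iff, hinj.eq_iff]
        rcases t with j | j | j <;> simp only [gadgetAdj] at ht
        · omega
        · simp only [GadgetVertex.path.injEq, Fin.ext_iff]; omega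
        · omega
  · right; left
    constructor
    · rw [hinput]; rfl
    · rw [hcenter, hendB, hinj.ne_iff]; simp
    · rw [hcenter, hnextB, hinj.ne_iff]; simp
    · rw [hcenter, hendA, hinj.ne_iff]; simp
    · rw [hcenter, hnextA, hinj.ne_iff]; simp
    · rw [hcenter, hendB, hcadj]; simp only [gadgetAdj]; omega
    · rw [hcenter, hendA, hcadj]; simp only [gadgetAdj]; omega
    · intro y hy
      obtain ⟨t, ht, rfl⟩ := hex y hy
      rw [hendB, hnextB, hinj.eq_iff, hinj.ne_iff, hadj]
      rcases t with j | j | j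
      · exact ht.elim
      · refine .inl (congrArg _ (Fin.ext ?_))
        simp only [gadgetAdj] at ht ⊢; omega
      · refine .inr ⟨by simp, .inr ht, .inr ?_, ?_⟩ <;> simp only [gadgetAdj] <;> omega

end Completeness

/-! ### The local conditions are sufficient -/

theorem Layout.IsCoherent.ne {D : Layout} {p : ℕ} (h : D.IsCoherent p) :
    D.endA ≠ D.endB ∧ D.endA ≠ D.nextB ∧ D.endB ≠ D.nextA := by
  obtain ⟨h1, h2, h3, h4, h5⟩ := h
  refine ⟨fun h => ?_, fun h => ?_, fun h => ?_⟩
  · rw [← h] at h3; omega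
  · rw [← h] at h4; omega
  · rw [h] at h3; omega

/-- The local conditions hold at all nodes of `G`. -/
structure FitsLayout (G : LabeledGraph) (id : Fin G.order → ℕ) (D : Layout) (p m : ℕ)
    (ΦA ΦB : SimpleGraph (Fin m) → Prop) : Prop where
  id_injective : Function.Injective id
  isLocallyValid : ∀ v, IsLocallyValid (view G id 1 v) D p m ΦA ΦB

/-- The node `v` takes itself for a node of Alice's gadget. -/
def OnAliceSide (G : LabeledGraph) (id : Fin G.order → ℕ) (D : Layout) (v : Fin G.order) : Prop :=
  IsGadgetView (view G id 1 v) D.endA D.nextA D.endB D.nextB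

/-- The node `v` takes itself for a node of Bob's gadget. -/
def OnBobSide (G : LabeledGraph) (id : Fin G.order → ℕ) (D : Layout) (v : Fin G.order) : Prop :=
  IsGadgetView (view G id 1 v) D.endB D.nextB D.endA D.nextA

/-- The node `v` takes itself for a node of the path. -/
def OnPath (G : LabeledGraph) (id : Fin G.order → ℕ) (D : Layout) (v : Fin G.order) : Prop :=
  ¬ OnAliceSide G id D v ∧ ¬ OnBobSide G id D v

section Soundness

variable {G : LabeledGraph} {id : Fin G.order → ℕ} {m p : ℕ} {D : Layout}
  {ΦA ΦB : SimpleGraph (Fin m) → Prop} {u v w : Fin G.order}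

theorem FitsLayout.coherent (hG : FitsLayout G id D p m ΦA ΦB) : D.IsCoherent p :=
  (hG.isLocallyValid ⟨0, G.order_pos⟩).coherent

theorem FitsLayout.center_adj_iff (hG : FitsLayout G id D p m ΦA ΦB) {y : ℕ} :
    (view G id 1 v).Adj (view G id 1 v).center y ↔ ∃ w, G.graph.Adj v w ∧ id w = y :=
  view_one_center_adj_iff hG.id_injective

theorem FitsLayout.center_adj (hG : FitsLayout G id D p m ΦA ΦB) (h : G.graph.Adj v w) :
    (view G id 1 v).Adj (view G id 1 v).center (id w) :=
  hG.center_adj_iff.2 ⟨w, h, rfl⟩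

theorem FitsLayout.exists_isEndView_endA (hG : FitsLayout G id D p m ΦA ΦB) (hv : id v = D.endA) :
    ∃ H h, IsEndView (view G id 1 v) false D.endA D.nextA D.endB D.nextB (m := m) H h ∧ ΦA H := by
  rcases (hG.isLocallyValid v).kind with h | h | h | ⟨H, h', h, -⟩ | h
  · exact absurd hv h.ne_end
  · exact absurd hv h.ne_end'
  · exact h
  · exact absurd (hv.symm.trans h.center_eq) hG.coherent.ne.1
  · exact absurd hv h.ne_endA

theorem FitsLayout.exists_isEndView_endB (hG : FitsLayout G id D p m ΦA ΦB) (hv : id v = D.endB) :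
    ∃ H h, IsEndView (view G id 1 v) true D.endB D.nextB D.endA D.nextA (m := m) H h ∧ ΦB H := by
  rcases (hG.isLocallyValid v).kind with h | h | ⟨H, h', h, -⟩ | h | h
  · exact absurd hv h.ne_end'
  · exact absurd hv h.ne_end
  · exact absurd (h.center_eq.symm.trans hv) hG.coherent.ne.1
  · exact h
  · exact absurd hv h.ne_endB

theorem FitsLayout.not_adj_ends (hG : FitsLayout G id D p m ΦA ΦB) (hu : id u = D.endA)
    (hv : id v = D.endB) : ¬ G.graph.Adj u v := fun h => by
  obtain ⟨H, h', hend, -⟩ := hG.exists_isEndView_endA hu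
  rcases (hend.adj_iff _).1 (hG.center_adj h) with heq | ⟨i, hi⟩
  · exact hG.coherent.ne.2.2 (hv.symm.trans heq)
  · exact hend.ne_end' i (hi.trans hv)

theorem FitsLayout.onAliceSide_of_adj (hG : FitsLayout G id D p m ΦA ΦB) (hvu : G.graph.Adj v u)
    (hu : id u = D.endA) (hv : id v ≠ D.nextA) : OnAliceSide G id D v := by
  have hadj := hG.center_adj hvu
  rcases (hG.isLocallyValid v).kind with h | h | ⟨H, h', h, -⟩ | ⟨H, h', h, -⟩ | h
  · exact h
  · exact absurd (hu ▸ hadj) h.not_adj_end'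
  · exact absurd (hG.id_injective (hu.trans h.center_eq.symm)) hvu.ne'
  · exact absurd hvu.symm (hG.not_adj_ends hu h.center_eq)
  · exact absurd (h.eq_nextA (hu ▸ hadj)) hv

theorem FitsLayout.onBobSide_of_adj (hG : FitsLayout G id D p m ΦA ΦB) (hvu : G.graph.Adj v u)
    (hu : id u = D.endB) (hv : id v ≠ D.nextB) : OnBobSide G id D v := by
  have hadj := hG.center_adj hvu
  rcases (hG.isLocallyValid v).kind with h | h | ⟨H, h', h, -⟩ | ⟨H, h', h, -⟩ | h
  · exact absurd (hu ▸ hadj) h.not_adj_end'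
  · exact h
  · exact absurd hvu (hG.not_adj_ends h.center_eq hu)
  · exact absurd (hG.id_injective (hu.trans h.center_eq.symm)) hvu.ne'
  · exact absurd (h.eq_nextB (hu ▸ hadj)) hv

/-- Alice's side has no neighbours but the first node of the path. -/
theorem FitsLayout.endA_or_onAliceSide_of_adj (hG : FitsLayout G id D p m ΦA ΦB) (hv : OnAliceSide G id D v)
    (hvw : G.graph.Adj v w) : id w = D.endA ∨ OnAliceSide G id D w := by
  refine (hv.closed _ (hG.center_adj hvw)).imp_right fun ⟨hne, hadj⟩ => ?_
  obtain ⟨-, u, -, hu⟩ := exists_of_view_adj hadj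
  rw [← hu, view_one_adj_iff hG.id_injective] at hadj
  exact hG.onAliceSide_of_adj hadj.2.2 hu hne

theorem FitsLayout.endB_or_onBobSide_of_adj (hG : FitsLayout G id D p m ΦA ΦB) (hv : OnBobSide G id D v)
    (hvw : G.graph.Adj v w) : id w = D.endB ∨ OnBobSide G id D w := by
  refine (hv.closed _ (hG.center_adj hvw)).imp_right fun ⟨hne, hadj⟩ => ?_
  obtain ⟨-, u, -, hu⟩ := exists_of_view_adj hadj
  rw [← hu, view_one_adj_iff hG.id_injective] at hadj
  exact hG.onBobSide_of_adj hadj.2.2 hu hne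

theorem FitsLayout.exists_adj_endA (hG : FitsLayout G id D p m ΦA ΦB) (hv : OnAliceSide G id D v) :
    ∃ u, G.graph.Adj v u ∧ id u = D.endA := hG.center_adj_iff.1 hv.adj_end

theorem FitsLayout.exists_adj_endB (hG : FitsLayout G id D p m ΦA ΦB) (hv : OnBobSide G id D v) :
    ∃ u, G.graph.Adj v u ∧ id u = D.endB := hG.center_adj_iff.1 hv.adj_end

theorem OnAliceSide.not_onBobSide (hv : OnAliceSide G id D v) : ¬ OnBobSide G id D v :=
  fun h => hv.not_adj_end' h.adj_end

theorem onPath_endA (hv : id v = D.endA) : OnPath G id D v :=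
  ⟨fun h => h.ne_end hv, fun h => h.ne_end' hv⟩

theorem onPath_endB (hv : id v = D.endB) : OnPath G id D v :=
  ⟨fun h => h.ne_end' hv, fun h => h.ne_end hv⟩

theorem onPath_nextA (hv : id v = D.nextA) : OnPath G id D v :=
  ⟨fun h => h.ne_next hv, fun h => h.ne_next' hv⟩

theorem onPath_nextB (hv : id v = D.nextB) : OnPath G id D v :=
  ⟨fun h => h.ne_next' hv, fun h => h.ne_next hv⟩

theorem onPath_of_isInnerView
    (hv : IsInnerView (view G id 1 v) D p) : OnPath G id D v :=
  ⟨fun h => h.ne_next (hv.eq_nextA h.adj_end), fun h => h.ne_next (hv.eq_nextB h.adj_end)⟩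

theorem OnPath.cases (hG : FitsLayout G id D p m ΦA ΦB) (hv : OnPath G id D v) :
    id v = D.endA ∨ id v = D.endB ∨ IsInnerView (view G id 1 v) D p := by
  rcases (hG.isLocallyValid v).kind with h | h | ⟨H, h', h, -⟩ | ⟨H, h', h, -⟩ | h
  · exact absurd h hv.1
  · exact absurd h hv.2
  · exact .inl h.center_eq
  · exact .inr (.inl h.center_eq)
  · exact .inr (.inr h)

theorem FitsLayout.onPath_of_adj (hG : FitsLayout G id D p m ΦA ΦB) (hv : IsInnerView (view G id 1 v) D p)
    (hvw : G.graph.Adj v w) : OnPath G id D w := by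
  have hpath := onPath_of_isInnerView hv
  constructor <;> intro hw
  · exact (hG.endA_or_onAliceSide_of_adj hw hvw.symm).elim hv.ne_endA hpath.1
  · exact (hG.endB_or_onBobSide_of_adj hw hvw.symm).elim hv.ne_endB hpath.2

/-- On the path, the position `0` belongs to the first node only. -/
theorem OnPath.eq_endA (hG : FitsLayout G id D p m ΦA ΦB) (hv : OnPath G id D v)
    (h : D.pos (id v) = 0) : id v = D.endA := by
  have hD := hG.coherent
  rcases hv.cases hG with hv | hv | hv
  · exact hv
  · have := hD.pos_endB; have := hD.four_le; rw [hv] at h; omega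
  · exact absurd h hv.pos_pos.ne'

theorem OnPath.eq_endB (hG : FitsLayout G id D p m ΦA ΦB) (hv : OnPath G id D v)
    (h : D.pos (id v) + 1 = p) : id v = D.endB := by
  have hD := hG.coherent
  rcases hv.cases hG with hv | hv | hv
  · have := hD.pos_endA; have := hD.four_le; rw [hv] at h; omega
  · exact hv
  · exact absurd h hv.pos_lt.ne

theorem OnPath.pos_lt (hG : FitsLayout G id D p m ΦA ΦB) (hv : OnPath G id D v) :
    D.pos (id v) < p := by
  have hD := hG.coherent
  rcases hv.cases hG with hv | hv | hv
  · rw [hv, hD.pos_endA]; have := hD.four_le; omega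
  · rw [hv]; have := hD.pos_endB; omega
  · exact (Nat.lt_succ_self _).trans hv.pos_lt

theorem OnPath.isInnerView (hG : FitsLayout G id D p m ΦA ΦB) (hv : OnPath G id D v)
    (h0 : D.pos (id v) ≠ 0) (h1 : D.pos (id v) + 1 ≠ p) : IsInnerView (view G id 1 v) D p := by
  have hD := hG.coherent
  rcases hv.cases hG with hv | hv | hv
  · exact absurd (hv ▸ hD.pos_endA) h0
  · exact absurd (hv ▸ hD.pos_endB) h1
  · exact hv

theorem FitsLayout.exists_adj_nextA (hG : FitsLayout G id D p m ΦA ΦB) (hv : id v = D.endA) :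
    ∃ w, G.graph.Adj v w ∧ id w = D.nextA := by
  obtain ⟨H, h', h, -⟩ := hG.exists_isEndView_endA hv
  exact hG.center_adj_iff.1 ((h.adj_iff _).2 (.inl rfl))

theorem FitsLayout.exists_adj_nextB (hG : FitsLayout G id D p m ΦA ΦB) (hv : id v = D.endB) :
    ∃ w, G.graph.Adj v w ∧ id w = D.nextB := by
  obtain ⟨H, h', h, -⟩ := hG.exists_isEndView_endB hv
  exact hG.center_adj_iff.1 ((h.adj_iff _).2 (.inl rfl))

/-- Walking along the path towards Alice. -/
theorem OnPath.exists_adj_pred (hG : FitsLayout G id D p m ΦA ΦB) (hv : OnPath G id D v) {i : ℕ}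
    (hi : D.pos (id v) = i + 1) : ∃ w, G.graph.Adj v w ∧ OnPath G id D w ∧ D.pos (id w) = i := by
  have hD := hG.coherent
  by_cases hlast : D.pos (id v) + 1 = p
  · obtain ⟨w, hvw, hw⟩ := hG.exists_adj_nextB (hv.eq_endB hG hlast)
    have := hD.pos_nextB
    exact ⟨w, hvw, onPath_nextB hw, by rw [hw]; omega⟩
  · have hin := hv.isInnerView hG (by omega) hlast
    obtain ⟨y, -, hy, -, hpos, -⟩ := hin.exists_adj
    obtain ⟨w, hvw, rfl⟩ := hG.center_adj_iff.1 hy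
    change _ = D.pos (id v) at hpos
    exact ⟨w, hvw, hG.onPath_of_adj hin hvw, by omega⟩

/-- Walking along the path towards Bob. -/
theorem OnPath.exists_adj_succ (hG : FitsLayout G id D p m ΦA ΦB) (hv : OnPath G id D v)
    (hi : D.pos (id v) + 1 < p) :
    ∃ w, G.graph.Adj v w ∧ OnPath G id D w ∧ D.pos (id w) = D.pos (id v) + 1 := by
  have hD := hG.coherent
  by_cases hfirst : D.pos (id v) = 0
  · obtain ⟨w, hvw, hw⟩ := hG.exists_adj_nextA (hv.eq_endA hG hfirst)
    have := hD.pos_nextA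
    exact ⟨w, hvw, onPath_nextA hw, by rw [hw]; omega⟩
  · have hin := hv.isInnerView hG hfirst hi.ne
    obtain ⟨-, z, -, hz, -, hpos, -⟩ := hin.exists_adj
    obtain ⟨w, hvw, rfl⟩ := hG.center_adj_iff.1 hz
    exact ⟨w, hvw, hG.onPath_of_adj hin hvw, hpos⟩

/-- Every node has an end of the path next to it or lies on the path, and the path can be followed
down to its first node. -/
theorem FitsLayout.exists_endA (hG : FitsLayout G id D p m ΦA ΦB) : ∃ v, id v = D.endA := by
  have hdown : ∀ i v, OnPath G id D v → D.pos (id v) = i → ∃ v, id v = D.endA := by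
    intro i
    induction i with
    | zero => exact fun v hv h => ⟨v, hv.eq_endA hG h⟩
    | succ i ih =>
      intro v hv h
      obtain ⟨w, -, hw, hwi⟩ := hv.exists_adj_pred hG h
      exact ih w hw hwi
  by_cases hA : OnAliceSide G id D ⟨0, G.order_pos⟩
  · obtain ⟨u, -, hu⟩ := hG.exists_adj_endA hA
    exact ⟨u, hu⟩
  by_cases hB : OnBobSide G id D ⟨0, G.order_pos⟩
  · obtain ⟨u, -, hu⟩ := hG.exists_adj_endB hB
    exact hdown _ u (onPath_endB hu) rfl
  · exact hdown _ _ ⟨hA, hB⟩ rfl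

theorem FitsLayout.exists_onPath (hG : FitsLayout G id D p m ΦA ΦB) {i : ℕ} (hi : i < p) :
    ∃ v, OnPath G id D v ∧ D.pos (id v) = i := by
  induction i with
  | zero =>
    obtain ⟨v, hv⟩ := hG.exists_endA
    exact ⟨v, onPath_endA hv, hv ▸ hG.coherent.pos_endA⟩
  | succ i ih =>
    obtain ⟨v, hv, rfl⟩ := ih (by omega)
    obtain ⟨w, -, hw⟩ := hv.exists_adj_succ hG hi
    exact ⟨w, hw⟩

/-- The first node of the path has one neighbour on the path only. -/
theorem OnPath.eq_nextA (hG : FitsLayout G id D p m ΦA ΦB) (hv : OnPath G id D v)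
    (hvw : G.graph.Adj v w) (hw : id w = D.endA) : id v = D.nextA :=
  of_not_not fun h => hv.1 (hG.onAliceSide_of_adj hvw hw h)

theorem OnPath.eq_nextB (hG : FitsLayout G id D p m ΦA ΦB) (hv : OnPath G id D v)
    (hvw : G.graph.Adj v w) (hw : id w = D.endB) : id v = D.nextB :=
  of_not_not fun h => hv.2 (hG.onBobSide_of_adj hvw hw h)

/-- An inner node of the path has one neighbour with the following position only. -/
theorem FitsLayout.eq_of_adj_of_pos_eq_succ (hG : FitsLayout G id D p m ΦA ΦB)
    (hu : IsInnerView (view G id 1 u) D p) (huv : G.graph.Adj u v) (huw : G.graph.Adj u w)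
    (hv : D.pos (id v) = D.pos (id u) + 1) (hw : D.pos (id w) = D.pos (id u) + 1) : v = w := by
  obtain ⟨y, z, -, -, hy, -, h⟩ := hu.exists_adj
  change _ = D.pos (id u) at hy
  have hne (x : Fin G.order) (hx : D.pos (id x) = D.pos (id u) + 1) : id x ≠ y := by
    rintro rfl; omega
  exact hG.id_injective (((h _ (hG.center_adj huv)).resolve_left (hne v hv)).trans
    ((h _ (hG.center_adj huw)).resolve_left (hne w hw)).symm)

/-- Different nodes of the path have different positions. -/
theorem OnPath.eq_of_pos_eq (hG : FitsLayout G id D p m ΦA ΦB) (hv : OnPath G id D v)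
    (hw : OnPath G id D w) (h : D.pos (id v) = D.pos (id w)) : v = w := by
  generalize hi : D.pos (id v) = i
  induction i generalizing v w with
  | zero => exact hG.id_injective ((hv.eq_endA hG hi).trans (hw.eq_endA hG (h.symm.trans hi)).symm)
  | succ i ih =>
    obtain ⟨u, hvu, hu, hui⟩ := hv.exists_adj_pred hG hi
    obtain ⟨u', hwu, hu', hui'⟩ := hw.exists_adj_pred hG (h.symm.trans hi)
    obtain rfl := ih hu hu' (hui.trans hui'.symm) hui
    have hvp := hv.pos_lt hG
    by_cases h0 : D.pos (id u) = 0
    · have hend := hu.eq_endA hG h0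
      exact hG.id_injective ((hv.eq_nextA hG hvu hend).trans (hw.eq_nextA hG hwu hend).symm)
    · exact hG.eq_of_adj_of_pos_eq_succ (hu.isInnerView hG h0 (by omega)) hvu.symm hwu.symm
        (by omega) (by omega)

theorem OnPath.adj_iff (hG : FitsLayout G id D p m ΦA ΦB) (hv : OnPath G id D v)
    (hw : OnPath G id D w) : G.graph.Adj v w ↔
      D.pos (id v) + 1 = D.pos (id w) ∨ D.pos (id w) + 1 = D.pos (id v) := by
  have hD := hG.coherent
  constructor
  · intro h
    rcases hv.cases hG with hv | hv | hv
    · rw [hw.eq_nextA hG h.symm hv, hv, hD.pos_endA, hD.pos_nextA]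
      exact .inl rfl
    · rw [hw.eq_nextB hG h.symm hv, hv]
      have := hD.pos_endB; have := hD.pos_nextB; omega
    · obtain ⟨y, z, -, -, hy, hz, hyz⟩ := hv.exists_adj
      change _ = D.pos (id v) at hy
      change _ = D.pos (id v) + 1 at hz
      rcases hyz _ (hG.center_adj h) with rfl | rfl
      · exact .inr hy
      · exact .inl hz.symm
  · have key : ∀ {v w}, OnPath G id D v → OnPath G id D w →
        D.pos (id v) + 1 = D.pos (id w) → G.graph.Adj v w := by
      intro v w hv hw h
      obtain ⟨w', hvw, hw', hpos⟩ := hv.exists_adj_succ hG (h ▸ hw.pos_lt hG)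
      rwa [hw'.eq_of_pos_eq hG hw (hpos.trans h)] at hvw
    exact fun h => h.elim (key hv hw) fun h => (key hw hv h).symm

theorem FitsLayout.exists_gadget_endA (hG : FitsLayout G id D p m ΦA ΦB) :
    ∃ (H : SimpleGraph (Fin m)) (h : Fin m → Fin G.order), ΦA H ∧ Function.Injective h ∧
      (∀ v, OnAliceSide G id D v ↔ ∃ i, h i = v) ∧
      (∀ i j, G.graph.Adj (h i) (h j) ↔ H.Adj i j) ∧
      ∀ i v, id v = D.endA → G.graph.Adj (h i) v := by
  obtain ⟨v, hv⟩ := hG.exists_endA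
  obtain ⟨H, h, hend, hΦ⟩ := hG.exists_isEndView_endA hv
  choose t htadj ht using fun i => hG.center_adj_iff.1 ((hend.adj_iff (h i)).2 (.inr ⟨i, rfl⟩))
  refine ⟨H, t, hΦ, fun i j hij => hend.injective (by rw [← ht, ← ht, hij]), fun w => ⟨?_, ?_⟩,
    fun i j => ?_, fun i u hu => ?_⟩
  · intro hw
    obtain ⟨u, hwu, hu⟩ := hG.exists_adj_endA hw
    obtain rfl : u = v := hG.id_injective (hu.trans hv.symm)
    obtain ⟨i, hi⟩ := ((hend.adj_iff _).1 (hG.center_adj hwu.symm)).resolve_left hw.ne_next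
    exact ⟨i, hG.id_injective ((ht i).trans hi)⟩
  · rintro ⟨i, rfl⟩
    exact hG.onAliceSide_of_adj (htadj i).symm hv (ht i ▸ hend.ne_next i)
  · rw [← hend.gadget_adj_iff, ← ht, ← ht, view_one_adj_iff hG.id_injective]
    exact ⟨fun h => ⟨.inr (htadj i), .inr (htadj j), h⟩, fun h => h.2.2⟩
  · obtain rfl : u = v := hG.id_injective (hu.trans hv.symm)
    exact (htadj i).symm

theorem FitsLayout.exists_gadget_endB (hG : FitsLayout G id D p m ΦA ΦB) :
    ∃ (H : SimpleGraph (Fin m)) (h : Fin m → Fin G.order), ΦB H ∧ Function.Injective h ∧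
      (∀ v, OnBobSide G id D v ↔ ∃ i, h i = v) ∧
      (∀ i j, G.graph.Adj (h i) (h j) ↔ H.Adj i j) ∧
      ∀ i v, id v = D.endB → G.graph.Adj (h i) v := by
  have hD := hG.coherent
  obtain ⟨v, hvp, hvpos⟩ := hG.exists_onPath (i := p - 1) (by have := hD.four_le; omega)
  have hv : id v = D.endB := hvp.eq_endB hG (by have := hD.four_le; omega)
  obtain ⟨H, h, hend, hΦ⟩ := hG.exists_isEndView_endB hv
  choose t htadj ht using fun i => hG.center_adj_iff.1 ((hend.adj_iff (h i)).2 (.inr ⟨i, rfl⟩))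
  refine ⟨H, t, hΦ, fun i j hij => hend.injective (by rw [← ht, ← ht, hij]), fun w => ⟨?_, ?_⟩,
    fun i j => ?_, fun i u hu => ?_⟩
  · intro hw
    obtain ⟨u, hwu, hu⟩ := hG.exists_adj_endB hw
    obtain rfl : u = v := hG.id_injective (hu.trans hv.symm)
    obtain ⟨i, hi⟩ := ((hend.adj_iff _).1 (hG.center_adj hwu.symm)).resolve_left hw.ne_next
    exact ⟨i, hG.id_injective ((ht i).trans hi)⟩
  · rintro ⟨i, rfl⟩
    exact hG.onBobSide_of_adj (htadj i).symm hv (ht i ▸ hend.ne_next i)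
  · rw [← hend.gadget_adj_iff, ← ht, ← ht, view_one_adj_iff hG.id_injective]
    exact ⟨fun h => ⟨.inr (htadj i), .inr (htadj j), h⟩, fun h => h.2.2⟩
  · obtain rfl : u = v := hG.id_injective (hu.trans hv.symm)
    exact (htadj i).symm

/-- A network all of whose nodes are satisfied is a gadget network. -/
theorem FitsLayout.exists_iso (hG : FitsLayout G id D p m ΦA ΦB) :
    ∃ (HA HB : SimpleGraph (Fin m)) (e : G.graph ≃g gadgetGraph p HA HB),
      (∀ v, G.nodeInput v = gadgetInput (e v)) ∧ (∀ d, G.edgeInput d = []) ∧ ΦA HA ∧ ΦB HB := by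
  have hD := hG.coherent
  obtain ⟨HA, hA, hΦA, hAinj, hAside, hAadj, hAend⟩ := hG.exists_gadget_endA
  obtain ⟨HB, hB, hΦB, hBinj, hBside, hBadj, hBend⟩ := hG.exists_gadget_endB
  choose t ht htpos using fun i : Fin p => hG.exists_onPath i.2
  have hA' (i) : OnAliceSide G id D (hA i) := (hAside _).2 ⟨i, rfl⟩
  have hB' (i) : OnBobSide G id D (hB i) := (hBside _).2 ⟨i, rfl⟩
  have hendA (i : Fin p) : id (t i) = D.endA ↔ (i : ℕ) = 0 :=
    ⟨fun h => by rw [← htpos, h, hD.pos_endA], fun h => (ht i).eq_endA hG (by rw [htpos, h])⟩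
  have hendB (i : Fin p) : id (t i) = D.endB ↔ (i : ℕ) + 1 = p :=
    ⟨fun h => by rw [← htpos, h, hD.pos_endB], fun h => (ht i).eq_endB hG (by rw [htpos, h])⟩
  have hApath (i j) : G.graph.Adj (hA i) (t j) ↔ (j : ℕ) = 0 :=
    ⟨fun h => (hendA j).1 ((hG.endA_or_onAliceSide_of_adj (hA' i) h).resolve_right (ht j).1),
      fun h => hAend i _ ((hendA j).2 h)⟩
  have hBpath (i j) : G.graph.Adj (hB i) (t j) ↔ (j : ℕ) + 1 = p :=
    ⟨fun h => (hendB j).1 ((hG.endB_or_onBobSide_of_adj (hB' i) h).resolve_right (ht j).2),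
      fun h => hBend i _ ((hendB j).2 h)⟩
  have hAB (i j) : ¬ G.graph.Adj (hA i) (hB j) := fun h =>
    (hG.endA_or_onAliceSide_of_adj (hA' i) h).elim (hB' j).ne_end'
      fun h => h.not_onBobSide (hB' j)
  let ψ : GadgetVertex m p → Fin G.order
    | .alice i => hA i
    | .path i => t i
    | .bob i => hB i
  have hψinj : Function.Injective ψ := by
    rintro (i | i | i) (j | j | j) h
    · exact congrArg _ (hAinj h)
    · exact absurd (show hA i = t j from h) fun h => (ht j).1 (h ▸ hA' i)
    · exact absurd (show hA i = hB j from h) fun h => (hA' i).not_onBobSide (h ▸ hB' j)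
    · exact absurd (show t i = hA j from h) fun h => (ht i).1 (h ▸ hA' j)
    · exact congrArg _ (Fin.ext (by rw [← htpos, ← htpos, show t i = t j from h]))
    · exact absurd (show t i = hB j from h) fun h => (ht i).2 (h ▸ hB' j)
    · exact absurd (show hB i = hA j from h) fun h => (hA' j).not_onBobSide (h ▸ hB' i)
    · exact absurd (show hB i = t j from h) fun h => (ht j).2 (h ▸ hB' i)
    · exact congrArg _ (hBinj h)
  have hψsurj : Function.Surjective ψ := fun v => by
    by_cases h1 : OnAliceSide G id D v
    · obtain ⟨i, rfl⟩ := (hAside v).1 h1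
      exact ⟨.alice i, rfl⟩
    by_cases h2 : OnBobSide G id D v
    · obtain ⟨i, rfl⟩ := (hBside v).1 h2
      exact ⟨.bob i, rfl⟩
    have hv : OnPath G id D v := ⟨h1, h2⟩
    exact ⟨.path ⟨_, hv.pos_lt hG⟩, (ht _).eq_of_pos_eq hG hv (htpos _)⟩
  have hψadj : ∀ x y, G.graph.Adj (ψ x) (ψ y) ↔ (gadgetGraph p HA HB).Adj x y := by
    rintro (i | i | i) (j | j | j)
    · exact hAadj i j
    · exact hApath i j
    · exact iff_of_false (hAB i j) not_false
    · exact (G.graph.adj_comm _ _).trans (hApath j i)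
    · refine ((ht i).adj_iff hG (ht j)).trans ?_
      rw [htpos, htpos]; rfl
    · exact (G.graph.adj_comm _ _).trans (hBpath j i)
    · exact iff_of_false (fun h => hAB j i h.symm) not_false
    · exact hBpath i j
    · exact hBadj i j
  let e : gadgetGraph p HA HB ≃g G.graph :=
    ⟨Equiv.ofBijective ψ ⟨hψinj, hψsurj⟩, fun {x y} => hψadj x y⟩
  refine ⟨HA, HB, e.symm, fun v => ?_, ?_, hΦA, hΦB⟩
  · obtain ⟨x, rfl⟩ := e.surjective v
    rw [e.symm_apply_apply]
    change G.nodeInput (ψ x) = gadgetInput x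
    rcases x with i | i | i
    · exact (mem_view_nodes_iff hG.id_injective).1 (hA' i).input
    · change G.nodeInput (t i) = _
      rcases (ht i).cases hG with h | h | h
      · obtain ⟨H, h', hend, -⟩ := hG.exists_isEndView_endA h
        rw [(mem_view_nodes_iff hG.id_injective).1 hend.input]
        simp [gadgetInput, (hendA i).1 h]
      · obtain ⟨H, h', hend, -⟩ := hG.exists_isEndView_endB h
        rw [(mem_view_nodes_iff hG.id_injective).1 hend.input]
        have := (hendB i).1 h
        have := hD.four_le
        rw [gadgetInput, if_neg (by omega), if_pos (by omega)]
      · rw [(mem_view_nodes_iff hG.id_injective).1 h.input, gadgetInput,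
          if_neg (fun h0 => h.ne_endA ((hendA i).2 h0)),
          if_neg (fun h0 => h.ne_endB ((hendB i).2 h0))]
    · exact (mem_view_nodes_iff hG.id_injective).1 (hB' i).input
  · rintro ⟨d, hd⟩
    induction d using Sym2.ind with
    | h u w =>
      have huw : G.graph.Adj u w := hd
      exact (hG.isLocallyValid u).edge_input (id u) (id w) _
        ⟨u, mem_ball_one_iff.2 (.inl rfl), w, mem_ball_one_iff.2 (.inr huw), huw, rfl⟩

end Soundness

/-! ### From communication to verification -/

/-- Layouts of gadget networks fit into strings of length `7 w` if all numbers involved have `w`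
bits: the size and the four identifiers take `w` bits each, the index of the function `pos` in the
family of `exists_hash_family` takes `2 w` bits. -/
theorem exists_layout_decoding (p : ℕ → ℕ) :
    ∃ lay : List Bool → Layout, ∀ (w n m : ℕ) (ν : GadgetVertex m (p n) → ℕ),
      Function.Injective ν → (∀ u, ν u < 2 ^ w) → 0 < w → n < 2 ^ w → 4 ≤ p n →
      hashBound (p n) ≤ 2 ^ w →
      ∃ l : List Bool, l.length = 7 * w ∧ (lay l).size = n ∧ (lay l).Describes ν := by
  have hF (w n : ℕ) : ∃ F : Fin (2 ^ (2 * w)) → ℕ → ℕ,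
      0 < w → 4 ≤ p n → hashBound (p n) ≤ 2 ^ w → ∀ x : Fin (p n) → ℕ, Function.Injective x →
        (∀ i, x i < 2 ^ w) → ∃ j, ∀ i, F j (x i) = i := by
    by_cases h : 0 < w ∧ 4 ≤ p n ∧ hashBound (p n) ≤ 2 ^ w
    · obtain ⟨F, hF⟩ := exists_hash_family h.1 (by omega) h.2.2
      exact ⟨F, fun _ _ _ => hF⟩
    · exact ⟨fun _ _ => 0, fun h1 h2 h3 => absurd ⟨h1, h2, h3⟩ h⟩
  choose F hF using hF
  have hdec (w : ℕ) := exists_decoding ((Fin 5 → Fin (2 ^ w)) × Fin (2 ^ (2 * w))) (s := 7 * w)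
    (by simp only [Fintype.card_prod, Fintype.card_fun, Fintype.card_fin, ← pow_mul, ← pow_add]
        exact Nat.pow_le_pow_right two_pos (by omega))
  choose dec hdec using hdec
  let code (l : List Bool) := dec (l.length / 7) l
  refine ⟨fun l => ⟨(code l).1 0, (code l).1 1, (code l).1 2, (code l).1 3, (code l).1 4,
    F (l.length / 7) ((code l).1 0) (code l).2⟩, fun w n m ν hν hlt hw hn hp hhash => ?_⟩
  obtain ⟨j, hj⟩ := hF w n hw hp hhash (fun i => ν (.path i))
    (fun i i' h => by simpa using hν h) fun i => hlt _
  let val (u : GadgetVertex m (p n)) : Fin (2 ^ w) := ⟨ν u, hlt u⟩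
  obtain ⟨l, hl, hdecl⟩ := hdec w (![⟨n, hn⟩, val (.path ⟨0, by omega⟩), val (.path ⟨1, by omega⟩),
    val (.path ⟨p n - 1, by omega⟩), val (.path ⟨p n - 2, by omega⟩)], j)
  have hw : l.length / 7 = w := by omega
  refine ⟨l, hl, ?_, ?_, ?_, ?_, ?_, ?_⟩ <;> simp only [code] <;> rw [hw, hdecl]
  · rfl
  · rintro ⟨i, hi⟩ rfl; rfl
  · rintro ⟨i, hi⟩ rfl; rfl
  · rintro ⟨i, hi⟩ h
    obtain rfl : i = p n - 1 := by simp only at h; omega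
    rfl
  · rintro ⟨i, hi⟩ h
    obtain rfl : i = p n - 2 := by simp only at h; omega
    rfl
  · exact hj

/-- Identifiers have `O(log N)` bits. -/
theorem isBigO_log_idRange {ρ : ℕ → ℕ} (hρ : IsPolyIdRange ρ) :
    (fun N => ((Nat.log 2 (ρ N) + 1 : ℕ) : ℝ)) =O[atTop] fun N : ℕ => Real.log N := by
  obtain ⟨hle, c, hc⟩ := hρ
  refine IsBigO.of_bound ((Real.log c + c) / Real.log 2 + 1) ?_
  filter_upwards [eventually_ge_atTop 3] with N hN
  have hN' : (3 : ℝ) ≤ N := by exact_mod_cast hN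
  have hlog : 1 ≤ Real.log N := by
    rw [Real.le_log_iff_exp_le (by linarith)]
    linarith [Real.exp_one_lt_d9]
  have hlog2 : 0 < Real.log 2 := Real.log_pos (by norm_num)
  have hc0 : c ≠ 0 := by
    rintro rfl
    have := hc N (by omega); have := hle N; omega
  have hρlog : Real.log (ρ N) ≤ Real.log c + c * Real.log N := by
    rw [← Real.log_pow, ← Real.log_mul (by exact_mod_cast hc0) (by positivity)]
    refine Real.log_le_log ?_ (by exact_mod_cast hc N (by omega))
    exact_mod_cast lt_of_lt_of_le (by omega : 0 < N) (hle N)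
  have hnat : (Nat.log 2 (ρ N) : ℝ) ≤ Real.log (ρ N) / Real.log 2 := Real.natLog_le_logb _ _
  rw [Real.norm_of_nonneg (by positivity), Real.norm_of_nonneg (by linarith)]
  push_cast
  have hc' : Real.log c ≤ Real.log c * Real.log N :=
    le_mul_of_one_le_right (Real.log_natCast_nonneg c) hlog
  calc (Nat.log 2 (ρ N) : ℝ) + 1 ≤ (Real.log c + c * Real.log N) / Real.log 2 + 1 := by
        gcongr; exact hnat.trans (by gcongr)
    _ ≤ ((Real.log c + c) * Real.log N) / Real.log 2 + Real.log N := by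
        gcongr; linarith
    _ = ((Real.log c + c) / Real.log 2 + 1) * Real.log N := by ring

section Verifier

variable (E : GadgetEncoding) (lay : List Bool → Layout) (s : ℕ → ℕ)
  (A B : ∀ n : ℕ, List (List Bool) → (Fin n → Bool) → Bool)

/-- The last certificate consists of a layout, which takes seven eighths of its length, and of the
last advice string. -/
def layoutPart (ls : List (List Bool)) : List Bool :=
  (ls.getLastD []).take (7 * ((ls.getLastD []).length / 8))

/-- The advice strings of length `t` contained in the certificates. -/
def advice (t : ℕ) (ls : List (List Bool)) : List (List Bool) :=
  ls.dropLast.map (List.take t) ++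
    [((ls.getLastD []).drop (7 * ((ls.getLastD []).length / 8))).take t]

/-- The end of the path next to Alice's gadget sees the whole gadget, reads off the input of Alice
and acts as Alice; likewise for Bob; all nodes check that the layout in the last certificate is
right. -/
noncomputable def gadgetVerifier : Verifier := fun V ls =>
  open Classical in
  let D := lay (layoutPart ls)
  decide (E.n₀ ≤ D.size ∧ IsLocallyValid V D (E.p D.size) (E.m D.size)
    (fun H => A D.size (advice (s D.size) ls) (E.φ D.size H) = true)
    (fun H => B D.size (advice (s D.size) ls) (E.φ D.size H) = true))

variable {E lay s A B}

theorem gadgetVerifier_eq_true_iff {V : View} {ls : List (List Bool)} {n : ℕ}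
    (hn : (lay (layoutPart ls)).size = n) :
    gadgetVerifier E lay s A B V ls = true ↔
      E.n₀ ≤ n ∧ IsLocallyValid V (lay (layoutPart ls)) (E.p n) (E.m n)
        (fun H => A n (advice (s n) ls) (E.φ n H) = true)
        (fun H => B n (advice (s n) ls) (E.φ n H) = true) := by
  subst hn
  simp only [gadgetVerifier, decide_eq_true_eq]

/-- Soundness: if all nodes accept, then `G` is a gadget network, the size in the layout is its
true size, and the advice makes Alice and Bob accept the strings encoded in `G`. -/
theorem exists_iso_of_gadgetVerifier {G : LabeledGraph} {id : Fin G.order → ℕ}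
    (hid : Function.Injective id) {ls : List (List Bool)}
    (h : ∀ v, gadgetVerifier E lay s A B (view G id 1 v) ls = true) :
    E.n₀ ≤ G.order ∧ ∃ (HA HB : SimpleGraph (Fin (E.m G.order)))
      (e : G.graph ≃g gadgetGraph (E.p G.order) HA HB),
      (∀ v, G.nodeInput v = gadgetInput (e v)) ∧ (∀ d, G.edgeInput d = []) ∧
      A G.order (advice (s G.order) ls) (E.φ G.order HA) = true ∧
      B G.order (advice (s G.order) ls) (E.φ G.order HB) = true := by
  obtain ⟨n, hn⟩ : ∃ n, (lay (layoutPart ls)).size = n := ⟨_, rfl⟩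
  simp only [gadgetVerifier_eq_true_iff hn] at h
  have hn₀ : E.n₀ ≤ n := (h ⟨0, G.order_pos⟩).1
  have hiso := FitsLayout.exists_iso ⟨hid, fun v => (h v).2⟩
  obtain rfl : n = G.order := by
    obtain ⟨HA, HB, e, -⟩ := hiso
    obtain ⟨σ⟩ := nonempty_fin_equiv_gadgetVertex (E.size_eq n hn₀)
    simpa using Fintype.card_congr (σ.trans e.symm.toEquiv)
  exact ⟨hn₀, hiso⟩

/-- The players of the verification game play the communication game, and the prover adds the
layout to the last advice string. The certificates have `8 w` bits, where `w = W N + s N`, so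
that the verifier can split the last one without knowing `N`. -/
theorem decidesGlobal_gadgetVerifier {f : BooleanFunction} {ρ : ℕ → ℕ} {W : ℕ → ℕ} {k : ℕ}
    (hE : ∀ n, E.n₀ ≤ n → 4 ≤ E.p n ∧ hashBound (E.p n) ≤ n) (hρ : ∀ N, N ≤ ρ N)
    (hW0 : ∀ N, 0 < W N) (hW : ∀ N, ρ N < 2 ^ W N)
    (hlay : ∀ (w n m : ℕ) (ν : GadgetVertex m (E.p n) → ℕ),
      Function.Injective ν → (∀ u, ν u < 2 ^ w) → 0 < w → n < 2 ^ w → 4 ≤ E.p n →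
      hashBound (E.p n) ≤ 2 ^ w →
      ∃ l : List Bool, l.length = 7 * w ∧ (lay l).size = n ∧ (lay l).Describes ν)
    (hAB : DecidesCC A B s (k + 1) (starter (k + 1)) f) :
    DecidesGlobal ρ 1 (gadgetVerifier E lay s A B) (fun N => 8 * (W N + s N)) (k + 1)
      (starter (k + 1)) (gadgetLanguage E f) := by
  intro G id ⟨hid, hidlt⟩
  -- Networks that are not gadget networks are rejected whatever the certificates.
  by_cases hG : E.n₀ ≤ G.order ∧ ∃ (HA HB : SimpleGraph (Fin (E.m G.order)))
      (e : G.graph ≃g gadgetGraph (E.p G.order) HA HB),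
      (∀ v, G.nodeInput v = gadgetInput (e v)) ∧ ∀ d, G.edgeInput d = []
  swap
  · refine iff_of_false (fun ⟨hn, HA, HB, e, hnode, hedge, _⟩ =>
      hG ⟨hn, HA, HB, e, hnode, hedge⟩) ?_
    rw [alternates_congr (Q := fun _ => False), alternates_const]
    · exact not_false
    · refine fun ls _ _ => iff_false_intro fun h => hG ?_
      obtain ⟨hn, HA, HB, e, hnode, hedge, -⟩ := exists_iso_of_gadgetVerifier hid h
      exact ⟨hn, HA, HB, e, hnode, hedge⟩
  obtain ⟨hn, HA, HB, e, hnode, hedge⟩ := hG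
  rw [mem_gadgetLanguage_iff hn e hnode hedge, ← hAB, alternates_starter_succ,
    alternates_starter_succ]
  beta_reduce
  obtain ⟨w, hw⟩ : ∃ w, W G.order + s G.order = w := ⟨_, rfl⟩
  rw [hw]
  symm
  -- All players but the last one play an advice string, padded to the length of a certificate.
  refine alternates_iff_of_map (τ := List.take (s G.order)) (fun l hl => by simp [hl]; omega)
    (fun c hc => ⟨c ++ List.replicate (8 * w - s G.order) false, by simp [hc]; omega,
      by rw [← hc, List.take_left]⟩)
    k _ fun ls _ _ => ⟨?_, ?_⟩
  · rintro ⟨l, hl, h⟩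
    obtain ⟨-, HA', HB', e', hnode', -, hA, hB⟩ := exists_iso_of_gadgetVerifier hid h
    obtain ⟨h1, h2⟩ := E.φ_eq_of_iso hn e e' hnode hnode'
    simp only [advice, List.dropLast_concat, List.getLastD_concat] at hA hB
    rw [← h1] at hA
    rw [← h2] at hB
    refine ⟨_, ?_, hA, hB⟩
    simp [hl]
    omega
  · rintro ⟨c, hc, hA, hB⟩
    have hNw : ρ G.order < 2 ^ w := (hW G.order).trans_le (Nat.pow_le_pow_right two_pos (by omega))
    obtain ⟨l, hl, hsize, hD⟩ := hlay w G.order _ (fun u => id (e.symm u)) (hid.comp e.symm.injective)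
      (fun u => (hidlt _).trans hNw) (by have := hW0 G.order; omega) ((hρ G.order).trans_lt hNw) (hE G.order hn).1
      (((hE G.order hn).2.trans (hρ G.order)).trans hNw.le)
    let tail := c ++ List.replicate (W G.order) false
    have htail : (l ++ tail).length = 8 * w := by simp [tail, hl, hc]; omega
    have hdiv : 7 * ((l ++ tail).length / 8) = l.length := by rw [htail, hl]; omega
    have hpart : layoutPart (ls ++ [l ++ tail]) = l := by
      simp only [layoutPart, List.getLastD_concat]
      rw [hdiv, List.take_left]
    have hadvice : advice (s G.order) (ls ++ [l ++ tail]) = ls.map (List.take (s G.order)) ++ [c] := by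
      simp only [advice, List.dropLast_concat, List.getLastD_concat]
      rw [hdiv, List.drop_left, ← hc, List.take_left]
    refine ⟨l ++ tail, htail, fun v => ?_⟩
    rw [gadgetVerifier_eq_true_iff (n := G.order) (by rw [hpart, hsize]), hpart, hadvice]
    exact ⟨hn, isLocallyValid_view hid e hnode hedge (hE G.order hn).1 hD hA hB v⟩

end Verifier

theorem mem_globalClass_of_mem_ccClass {E : GadgetEncoding}
    (hE : ∀ n, E.n₀ ≤ n → 4 ≤ E.p n ∧ hashBound (E.p n) ≤ n) {f : BooleanFunction} {ρ : ℕ → ℕ}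
    (hρ : IsPolyIdRange ρ) {g : ℕ → ℝ} (hg : (fun n : ℕ => Real.log (n : ℝ)) =O[atTop] g) {k : ℕ}
    (hk : 1 ≤ k) (h : f ∈ ccClass (starter k) k g) :
    gadgetLanguage E f ∈ globalClass ρ (starter k) k g := by
  obtain ⟨k, rfl⟩ : ∃ j, k = j + 1 := ⟨k - 1, by omega⟩
  obtain ⟨s, A, B, hs, hAB⟩ := h
  obtain ⟨lay, hlay⟩ := exists_layout_decoding E.p
  refine ⟨fun N => 8 * (Nat.log 2 (ρ N) + 1 + s N), 1, gadgetVerifier E lay s A B, ?_,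
    decidesGlobal_gadgetVerifier (W := fun N => Nat.log 2 (ρ N) + 1) hE hρ.1
      (fun N => Nat.succ_pos _) (fun N => Nat.lt_pow_succ_log_self one_lt_two _) hlay hAB⟩
  have := ((((isBigO_log_idRange hρ).trans hg).add hs).const_mul_left (8 : ℝ))
  refine this.congr_left fun N => ?_
  push_cast
  ring

end CertHierarchy

theorem mainTheorem4 (f : CertHierarchy.BooleanFunction) :
    ∃ (L : Set CertHierarchy.LabeledGraph),
      (∃ E : CertHierarchy.GadgetEncoding, L = CertHierarchy.gadgetLanguage E f) ∧
      ∀ ρ : ℕ → ℕ, CertHierarchy.IsPolyIdRange ρ →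
      ∀ g : ℕ → ℝ, (fun n : ℕ => Real.log (n : ℝ)) =O[Filter.atTop] g →
      ∀ k : ℕ, 1 ≤ k →
        (L ∈ CertHierarchy.LambdaG ρ k g ↔
          f ∈ (if Odd k then CertHierarchy.SigmaCC k g else CertHierarchy.PiCC k g)) := by
  obtain ⟨E, hp, hE⟩ := CertHierarchy.exists_gadgetEncoding
  refine ⟨_, ⟨E, rfl⟩, fun ρ hρ g hg k hk => ?_⟩
  have hclass : CertHierarchy.LambdaG ρ k g =
      CertHierarchy.globalClass ρ (CertHierarchy.starter k) k g := by
    rw [CertHierarchy.LambdaG, CertHierarchy.starter_eq_ite]; split_ifs <;> rfl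
  have hclass' : (if Odd k then CertHierarchy.SigmaCC k g else CertHierarchy.PiCC k g) =
      CertHierarchy.ccClass (CertHierarchy.starter k) k g := by
    rw [CertHierarchy.starter_eq_ite]; split_ifs <;> rfl
  rw [hclass, hclass']
  exact ⟨CertHierarchy.mem_ccClass_of_mem_globalClass hp hρ.1 hk,
    CertHierarchy.mem_globalClass_of_mem_ccClass hE hρ hg hk⟩
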